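/- Let $G=PSL_2(\mathbb{R})$, $h(x)=\begin{pmatrix}1&x\\0&1\end{pmatrix}$, $a(y)=\begin{pmatrix}y^{1/2}&0\\0&y^{-1/2}\end{pmatrix}$, $k(\theta)=\begin{pmatrix}\cos\theta&\sin\theta\\-\sin\theta&\cos\theta\end{pmatrix}$. Let $d_G$ be the distance of the left-invariant Riemannian metric on $G$ which at the identity (hence at all points $h(x)a(y)$) is $\frac{dx^2+dy^2}{y^2}+d\theta^2$ in the coordinates $g=h(x)a(y)k(\theta)$. Let $\Gamma\subset G$ be a lattice (a discrete subgroup of finite covolume for the Haar measure) such that $X=\Gamma\backslash G$ is not compact, and let $d_X(\Gamma g_1,\Gamma g_2)=\inf_{\gamma\in\Gamma}d_G(g_1,\gamma g_2)$. Fix $p_0\in X$. For $p\in X$ and $T\ge 0$ put $$r=r(p,T)=T\exp\bigl(-d_X(p\,a(T),\,p_0)\bigr)\qquad (r=0\text{ if }T=0).$$ A point $\xi\in X$ lies on a closed horocycle of period $P$ if $P$ is the least positive $t$ with $\xi h(t)=\xi$. There is a constant $C\ge 1$, depending only on $\Gamma$ and $p_0$, such that for all $p\in X$, $T\ge 0$,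 $\delta>0$ and $K\le T$ the following hold. 1. There is an interval $I_0\subset[0,T]$ of length $|I_0|\le\delta^{-1}\max(K,C)^2$ such that for every $t_0\in[0,T]\setminus I_0$ there is a point $\xi\in X$ on a closed horocycle of period $P$ with $$d_X\bigl(p\,h(t_0+t),\,\xi h(t)\bigr)\le\delta\quad\text{for all }0\le t\le K,\qquad\text{and}\qquad P\le C\,r.$$ 2. For every $\eta>0$ there is an interval $I_0\subset[0,T]$ of length $|I_0|\le\max\bigl(\delta^{-1}\max(K,C)^2,\ \eta T\bigr)$ such that for every $t_0\in[0,T]\setminus I_0$ there is a point $\xi\in X$ on a closed horocycle of period $P$ with $$d_X\bigl(p\,h(t_0+t),\,\xi h(t)\bigr)\le\delta\quad\text{for all }0\le t\le K,\qquad\text{and}\qquad C^{-1}\eta^2 r\le P\le C\,r.$$ In particular, for $K\ge C$ the term $\max(K,C)^2$ is $K^2$. -/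

import Mathlib

open scoped MatrixGroups

noncomputable section

namespace Horocycle

/-- The group `PSL₂(ℝ)`, with the quotient topology of `SL₂(ℝ)`. -/
abbrev PSL2R : Type := Matrix.ProjectiveSpecialLinearGroup (Fin 2) ℝ

/-- The projection `SL₂(ℝ) → PSL₂(ℝ)`. -/
abbrev proj (g : SL(2, ℝ)) : PSL2R := QuotientGroup.mk g

/-! ### The left-invariant Riemannian metric on `PSL₂(ℝ)` -/

/-- The norm on `𝔰𝔩₂(ℝ)` for which the velocities at the identity of `x ↦ h(x)`, `y ↦ a(y)`,
`θ ↦ k(θ)`, that is `(0 1; 0 0)`, `(1/2 0; 0 -1/2)`, `(0 1; -1 0)`, are orthonormal. The trace-free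
matrix `A` has the coordinates `A₀₁ + A₁₀`, `2 A₀₀`, `-A₁₀` in this basis. -/
def lieNorm (A : Matrix (Fin 2) (Fin 2) ℝ) : ℝ :=
  Real.sqrt ((A 0 1 + A 1 0) ^ 2 + (2 * A 0 0) ^ 2 + (A 1 0) ^ 2)

/-- `C¹` curves in `SL₂(ℝ)`: all the matrix entries are `C¹`. -/
def IsC1Curve (γ : ℝ → SL(2, ℝ)) : Prop :=
  ∀ i j : Fin 2, ContDiff ℝ 1 fun t => (γ t : Matrix (Fin 2) (Fin 2) ℝ) i j

/-- The velocity of a curve, translated back to the identity: `γ(t)⁻¹ γ'(t)`. -/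
def bodyVelocity (γ : ℝ → SL(2, ℝ)) (t : ℝ) : Matrix (Fin 2) (Fin 2) ℝ :=
  ((γ t)⁻¹ : SL(2, ℝ)).val *
    Matrix.of fun i j => deriv (fun s => (γ s : Matrix (Fin 2) (Fin 2) ℝ) i j) t

/-- The length of `γ` on `[0, 1]` for the left-invariant Riemannian metric given by `lieNorm`. -/
def curveLength (γ : ℝ → SL(2, ℝ)) : ℝ :=
  ∫ t in (0 : ℝ)..1, lieNorm (bodyVelocity γ t)

/-- The left-invariant Riemannian distance `d_G` on `G = PSL₂(ℝ)`: the infimum of the lengths of the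
curves joining the two points. (Curves in `PSL₂(ℝ)` are written as projections of curves in the
double cover `SL₂(ℝ)`.) -/
def dG (g₁ g₂ : PSL2R) : ℝ :=
  sInf {L : ℝ | ∃ γ : ℝ → SL(2, ℝ), IsC1Curve γ ∧ proj (γ 0) = g₁ ∧ proj (γ 1) = g₂ ∧
    L = curveLength γ}

/-! ### One-parameter subgroups -/

/-- The matrix `(1 x; 0 1)` in `SL₂(ℝ)`. -/
def hSL (x : ℝ) : SL(2, ℝ) := ⟨!![1, x; 0, 1], by simp [Matrix.det_fin_two_of]⟩

/-- `h(x) = (1 x; 0 1)` in `PSL₂(ℝ)`. -/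
def h (x : ℝ) : PSL2R := proj (hSL x)

/-- The matrix `(e^{t/2} 0; 0 e^{-t/2})` in `SL₂(ℝ)`. -/
def aExpSL (t : ℝ) : SL(2, ℝ) :=
  ⟨!![Real.exp (t / 2), 0; 0, Real.exp (-(t / 2))], by
    rw [Matrix.det_fin_two_of, ← Real.exp_add]; simp⟩

/-- `a(e^t) = (e^{t/2} 0; 0 e^{-t/2})` in `PSL₂(ℝ)`. -/
def aExp (t : ℝ) : PSL2R := proj (aExpSL t)

/-! ### The space `X = Γ \ G` -/

/-- `X = Γ \ G`, the orbits of the action of `Γ` on `G` by left multiplication, with the quotient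
topology. -/
abbrev X (Γ : Subgroup PSL2R) : Type := MulAction.orbitRel.Quotient Γ PSL2R

/-- The point `Γ g` of `X`. -/
abbrev pt (Γ : Subgroup PSL2R) (g : PSL2R) : X Γ := Quotient.mk (MulAction.orbitRel Γ PSL2R) g

/-- Right translation `Γ g ↦ Γ g u` on `X`. -/
def rightMul (Γ : Subgroup PSL2R) (p : X Γ) (u : PSL2R) : X Γ :=
  Quotient.map (fun g => g * u) (by
    rintro g₁ g₂ ⟨c, hc⟩
    exact ⟨c, by simp only [← hc, Subgroup.smul_def, smul_eq_mul, mul_assoc]⟩) p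

/-- The horocycle flow `h_t(p) = p h(t)`. -/
def hflow (Γ : Subgroup PSL2R) (t : ℝ) (p : X Γ) : X Γ := rightMul Γ p (h t)

/-- The geodesic flow `g_t(p) = p a(e^t)`. -/
def gflow (Γ : Subgroup PSL2R) (t : ℝ) (p : X Γ) : X Γ := rightMul Γ p (aExp t)

/-- The distance on `X`: the infimum of the distances of the representatives. By left-invariance,
`dX (Γ g₁) (Γ g₂)` is the infimum of `dG g₁ (c g₂)` over `c ∈ Γ`. -/
def dX (Γ : Subgroup PSL2R) (p q : X Γ) : ℝ :=
  sInf {d : ℝ | ∃ g₁ g₂ : PSL2R, pt Γ g₁ = p ∧ pt Γ g₂ = q ∧ d = dG g₁ g₂}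

/-- `Γ` is a lattice: discrete and of finite covolume with respect to the Haar measure `μ`. -/
structure IsLattice [MeasurableSpace PSL2R] (μ : MeasureTheory.Measure PSL2R)
    (Γ : Subgroup PSL2R) : Prop where
  discrete : DiscreteTopology Γ
  finite_covolume : ∃ F : Set PSL2R, MeasureTheory.IsFundamentalDomain Γ F μ ∧ μ F < ⊤

/-- The orbit `t ↦ ξ h(t)` is a closed horocycle of period `P` (the least positive period). -/
def IsClosedHorocycle (Γ : Subgroup PSL2R) (ξ : X Γ) (P : ℝ) : Prop :=
  IsLeast {t : ℝ | 0 < t ∧ hflow Γ t ξ = ξ} P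

/-- `r = T exp(-dist(g_{log T}(p)))`, where `dist(q) = d_X(q, p₀)`. -/
def r (Γ : Subgroup PSL2R) (p₀ : X Γ) (T : ℝ) (p : X Γ) : ℝ :=
  T * Real.exp (-dX Γ (gflow Γ (Real.log T) p) p₀)

/-- The piece `{p h(t₀ + t) : 0 ≤ t ≤ K}` is approximated of order `δ` by the segment
`{ξ h(t) : 0 ≤ t ≤ K}`. -/
def Approximates (Γ : Subgroup PSL2R) (δ K : ℝ) (p : X Γ) (t₀ : ℝ) (ξ : X Γ) : Prop :=
  ∀ t : ℝ, 0 ≤ t → t ≤ K → dX Γ (hflow Γ (t₀ + t) p) (hflow Γ t ξ) ≤ δ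

end Horocycle

end

noncomputable section

namespace Horocycle

/-! ### Matrices of size two -/

/-! A unipotent element of `g⁻¹ Γ g` is recorded, up to inversion, by a fixed vector `v = (x, y)`,
through `unip x y`; conjugation acts linearly on `v` (`conj_unip`). A horizontal vector `(z, 0)`
means that `Γ g` lies on a closed horocycle whose period is at most `z²`. Moving along the horocycle
for time `t` turns `(x, y)` into `(x - t y, y)`, which is nearly horizontal unless `t` is close to
`x / y`.

If the vector is nearly horizontal at the midpoint of a piece of length `K`, a small lower
triangular shear makes it exactly horizontal. Such a shear `c` moves points by at most `|c| (2 +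
τ²)` at time `τ` from the midpoint, whence the condition `(2 + κ²) |y| < δ |z|` of
`exists_approximates`, with `2κ ≥ K`. One vector serves all `t₀`, so the failures lie in one
interval of length of order `δ⁻¹ K²` for large `K` (`exists_bad_interval`).

The vector is chosen at the renormalized point `Γ g a(T)`, where its squared length is bounded by a
constant times `exp (-d)`, `d` being the distance to the base point (`exists_short_unip`). Undoing
`a(T)` gives `z² ≤ 4 T |v|²`, the upper bound for the period. Conversely no fixed vector there has
squared length below a constant times `exp (-d)` (`exists_unip_lower_bound`), because along a curve
of length `L` squared norms grow by at most `exp L`. Applied to the vector belonging to the exact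
period, this gives the lower bound, with a loss `η²` when `t₀` stays at distance `ηT/2` from the bad
time.

The short vector comes from a thick-thin decomposition. Commutators of small elements are smaller
still, so a shortest element commutes with every other small one and stays shortest while it stays
small (`IsShortest.conj`). Finite covolume makes the thick part bounded modulo `Γ`
(`exists_bound_of_isThick`). Pushing a short element to the boundary of the thick part puts a
conjugate of it into a fixed finite set of `Γ`, so very short elements have trace two
(`exists_trace_eq_two`). The length of the path back to the thick part is logarithmic in the squared
length of the vector, which gives `exp (-d)` with the right exponent. -/

/-- The square of the Frobenius norm. -/
def nsq (A : Matrix (Fin 2) (Fin 2) ℝ) : ℝ := A 0 0 ^ 2 + A 0 1 ^ 2 + A 1 0 ^ 2 + A 1 1 ^ 2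

theorem nsq_nonneg (A : Matrix (Fin 2) (Fin 2) ℝ) : 0 ≤ nsq A := by
  unfold nsq; positivity

theorem nsq_mul_le (A B : Matrix (Fin 2) (Fin 2) ℝ) : nsq (A * B) ≤ nsq A * nsq B := by
  have key : ∀ a b c d : ℝ, (a * c + b * d) ^ 2 ≤ (a ^ 2 + b ^ 2) * (c ^ 2 + d ^ 2) :=
    fun a b c d => by nlinarith [sq_nonneg (a * d - b * c)]
  simp only [nsq, Matrix.mul_apply, Fin.sum_univ_two]
  linarith [key (A 0 0) (A 0 1) (B 0 0) (B 1 0), key (A 0 0) (A 0 1) (B 0 1) (B 1 1),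
    key (A 1 0) (A 1 1) (B 0 0) (B 1 0), key (A 1 0) (A 1 1) (B 0 1) (B 1 1)]

theorem nsq_add_le (A B : Matrix (Fin 2) (Fin 2) ℝ) : nsq (A + B) ≤ 2 * nsq A + 2 * nsq B := by
  simp only [nsq, Matrix.add_apply]
  nlinarith [sq_nonneg (A 0 0 - B 0 0), sq_nonneg (A 0 1 - B 0 1), sq_nonneg (A 1 0 - B 1 0),
    sq_nonneg (A 1 1 - B 1 1)]

theorem nsq_sub_le (A B : Matrix (Fin 2) (Fin 2) ℝ) : nsq (A - B) ≤ 2 * nsq A + 2 * nsq B := by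
  simp only [nsq, Matrix.sub_apply]
  nlinarith [sq_nonneg (A 0 0 + B 0 0), sq_nonneg (A 0 1 + B 0 1), sq_nonneg (A 1 0 + B 1 0),
    sq_nonneg (A 1 1 + B 1 1)]

theorem nsq_eq_zero_iff {A : Matrix (Fin 2) (Fin 2) ℝ} : nsq A = 0 ↔ A = 0 := by
  constructor
  · intro h
    unfold nsq at h
    ext i j
    fin_cases i <;> fin_cases j <;> simp only [Matrix.zero_apply, Fin.zero_eta, Fin.mk_one] <;>
    · apply pow_eq_zero_iff two_ne_zero |>.1
      nlinarith [sq_nonneg (A 0 0), sq_nonneg (A 0 1), sq_nonneg (A 1 0), sq_nonneg (A 1 1)]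
  · rintro rfl; simp [nsq]

theorem continuous_nsq : Continuous nsq := by unfold nsq; fun_prop

theorem nsq_one : nsq 1 = 2 := by norm_num [nsq]

theorem nsq_le_of_sub_one (A : Matrix (Fin 2) (Fin 2) ℝ) : nsq A ≤ 2 * nsq (A - 1) + 4 := by
  have := nsq_add_le (A - 1) 1
  rw [sub_add_cancel, nsq_one] at this
  linarith

/-! ### The group `SL₂(ℝ)` -/

theorem det_eq (g : SL(2, ℝ)) : g.1 0 0 * g.1 1 1 - g.1 0 1 * g.1 1 0 = 1 := by
  rw [← Matrix.det_fin_two]; exact g.2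

theorem inv_val (g : SL(2, ℝ)) : (g⁻¹).1 = !![g.1 1 1, -g.1 0 1; -g.1 1 0, g.1 0 0] := by
  rw [Matrix.SpecialLinearGroup.coe_inv, Matrix.adjugate_fin_two]

theorem mul_val (g m : SL(2, ℝ)) : (g * m).1 =
    !![g.1 0 0 * m.1 0 0 + g.1 0 1 * m.1 1 0, g.1 0 0 * m.1 0 1 + g.1 0 1 * m.1 1 1;
      g.1 1 0 * m.1 0 0 + g.1 1 1 * m.1 1 0, g.1 1 0 * m.1 0 1 + g.1 1 1 * m.1 1 1] := by
  ext i j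
  fin_cases i <;> fin_cases j <;>
    simp [Matrix.SpecialLinearGroup.coe_mul, Matrix.mul_apply, Fin.sum_univ_two]

theorem sl_ext {g m : SL(2, ℝ)} (h00 : g.1 0 0 = m.1 0 0) (h01 : g.1 0 1 = m.1 0 1)
    (h10 : g.1 1 0 = m.1 1 0) (h11 : g.1 1 1 = m.1 1 1) : g = m := by
  ext i j
  fin_cases i <;> fin_cases j <;> assumption

theorem nsq_inv (g : SL(2, ℝ)) : nsq (g⁻¹).1 = nsq g.1 := by
  rw [inv_val]; simp [nsq]; ring

theorem nsq_mul_val_le (g m : SL(2, ℝ)) : nsq (g * m).1 ≤ nsq g.1 * nsq m.1 :=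
  nsq_mul_le g.1 m.1

theorem two_le_nsq (g : SL(2, ℝ)) : 2 ≤ nsq g.1 := by
  unfold nsq
  nlinarith [det_eq g, sq_nonneg (g.1 0 0 - g.1 1 1), sq_nonneg (g.1 0 1 + g.1 1 0)]

/-- The squared distance of an element of `SL₂(ℝ)` to the identity in the Frobenius norm. -/
def size (m : SL(2, ℝ)) : ℝ := nsq (m.1 - 1)

theorem size_nonneg (m : SL(2, ℝ)) : 0 ≤ size m := nsq_nonneg _

theorem size_eq (m : SL(2, ℝ)) : size m =
    (m.1 0 0 - 1) ^ 2 + m.1 0 1 ^ 2 + m.1 1 0 ^ 2 + (m.1 1 1 - 1) ^ 2 := by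
  simp [size, nsq]

theorem size_eq_zero_iff {m : SL(2, ℝ)} : size m = 0 ↔ m = 1 := by
  rw [size, nsq_eq_zero_iff, sub_eq_zero]
  exact ⟨fun h => Subtype.ext h, fun h => by rw [h]; rfl⟩

theorem size_neg_one : size (-1) = 8 := by
  rw [size_eq]
  norm_num [Matrix.SpecialLinearGroup.coe_neg]

theorem nsq_le_of_size (m : SL(2, ℝ)) : nsq m.1 ≤ 2 * size m + 4 := nsq_le_of_sub_one _

theorem continuous_size : Continuous size :=
  continuous_nsq.comp (continuous_subtype_val.sub continuous_const)

/-- The commutator minus the identity is the additive commutator of `m - 1` and `n - 1` times `(n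
m)⁻¹`, hence quadratically small. -/
theorem size_commutator_le (m n : SL(2, ℝ)) :
    size (m * n * m⁻¹ * n⁻¹) ≤ 4 * size m * size n * (nsq m.1 * nsq n.1) := by
  have e : (m * n * m⁻¹ * n⁻¹).1 - 1 =
      ((m.1 - 1) * (n.1 - 1) - (n.1 - 1) * (m.1 - 1)) * (m⁻¹ * n⁻¹).1 := by
    have e1 : (m.1 - 1) * (n.1 - 1) - (n.1 - 1) * (m.1 - 1) = (m * n).1 - (n * m).1 := by
      simp only [Matrix.SpecialLinearGroup.coe_mul]; noncomm_ring
    have e2 : (n * m).1 * (m⁻¹ * n⁻¹).1 = 1 := by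
      rw [← Matrix.SpecialLinearGroup.coe_mul]; simp
    rw [e1, sub_mul, e2, ← Matrix.SpecialLinearGroup.coe_mul]
    simp only [mul_assoc]
  have h1 := nsq_mul_le (m.1 - 1) (n.1 - 1)
  have h2 := nsq_mul_le (n.1 - 1) (m.1 - 1)
  have h3 := nsq_sub_le ((m.1 - 1) * (n.1 - 1)) ((n.1 - 1) * (m.1 - 1))
  have h4 := nsq_mul_val_le m⁻¹ n⁻¹
  rw [nsq_inv, nsq_inv] at h4
  rw [size, e]
  refine (nsq_mul_le _ _).trans ?_
  unfold size
  refine mul_le_mul (by linarith) h4 (nsq_nonneg _) ?_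
  have := nsq_nonneg (m.1 - 1)
  have := nsq_nonneg (n.1 - 1)
  positivity

/-- Small elements commute with those whose commutator with them is not smaller. -/
theorem size_commutator_lt {m n : SL(2, ℝ)} (hm : size m ≤ 1 / 100) (hn : size n ≤ 1 / 100)
    (hm1 : m ≠ 1) : size (m * n * m⁻¹ * n⁻¹) < size m := by
  have hpos : 0 < size m := lt_of_le_of_ne (size_nonneg m) fun h => hm1 (size_eq_zero_iff.1 h.symm)
  have h1 := size_commutator_le m n
  -- The total factor `4 · (1/100) · (201/50)²` is below one; this is why the threshold `1/100`
  -- works.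
  have hM : nsq m.1 ≤ 201 / 50 := by linarith [nsq_le_of_size m]
  have hN : nsq n.1 ≤ 201 / 50 := by linarith [nsq_le_of_size n]
  have h2 : nsq m.1 * nsq n.1 ≤ 201 / 50 * (201 / 50) :=
    mul_le_mul hM hN (nsq_nonneg _) (by norm_num)
  have h3 : 4 * size m * size n * (nsq m.1 * nsq n.1) ≤
      4 * size m * (1 / 100) * (201 / 50 * (201 / 50)) := by
    refine mul_le_mul ?_ h2 (mul_nonneg (nsq_nonneg _) (nsq_nonneg _)) (by positivity)
    exact mul_le_mul_of_nonneg_left hn (by positivity)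
  linarith

/-! ### Unipotent elements, their fixed vectors, and the Iwasawa decomposition. -/

/-- The unipotent element `1 + v vᵀ J` fixing the vector `v = (x, y)`. -/
def unip (x y : ℝ) : SL(2, ℝ) :=
  ⟨!![1 - x * y, x ^ 2; -y ^ 2, 1 + x * y], by rw [Matrix.det_fin_two_of]; ring⟩

theorem unip_val (x y : ℝ) : (unip x y).1 = !![1 - x * y, x ^ 2; -y ^ 2, 1 + x * y] := rfl

theorem hSL_val (x : ℝ) : (hSL x).1 = !![1, x; 0, 1] := rfl

theorem aExpSL_val (t : ℝ) :
    (aExpSL t).1 = !![Real.exp (t / 2), 0; 0, Real.exp (-(t / 2))] := rfl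

/-- Determinant one gives `J g⁻¹ = gᵀ J`, so `g (1 + v vᵀ J) g⁻¹ = 1 + (g v)(g v)ᵀ J`. -/
theorem conj_unip (g : SL(2, ℝ)) (x y : ℝ) : g * unip x y * g⁻¹ =
    unip (g.1 0 0 * x + g.1 0 1 * y) (g.1 1 0 * x + g.1 1 1 * y) := by
  have hd := det_eq g
  apply sl_ext <;> simp only [mul_val, inv_val, unip_val, Matrix.of_apply,
    Matrix.cons_val', Matrix.cons_val_zero, Matrix.cons_val_one, Matrix.cons_val_fin_one]
  · linear_combination hd
  · ring
  · ring
  · linear_combination hd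

theorem size_unip (x y : ℝ) : size (unip x y) = (x ^ 2 + y ^ 2) ^ 2 := by
  rw [size_eq]; simp [unip]; ring

theorem unip_zero_right (x : ℝ) : unip x 0 = hSL (x ^ 2) := by
  apply sl_ext <;> simp [unip, hSL]

theorem unip_eq_one_iff {x y : ℝ} : unip x y = 1 ↔ x = 0 ∧ y = 0 := by
  rw [← size_eq_zero_iff, size_unip]
  constructor
  · intro h
    have h2 : x ^ 2 + y ^ 2 = 0 := pow_eq_zero_iff two_ne_zero |>.1 h
    constructor <;> nlinarith
  · rintro ⟨rfl, rfl⟩; simp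

/-- An element of trace two, or its inverse, is of the form `unip x y`. -/
theorem exists_unip_of_trace {n : SL(2, ℝ)} (h : n.1 0 0 + n.1 1 1 = 2) :
    ∃ x y : ℝ, n = unip x y ∨ n⁻¹ = unip x y := by
  have hd := det_eq n
  have key : ∀ p q r : ℝ, 0 ≤ q → 0 ≤ r → p ^ 2 = q * r →
      ∃ x y : ℝ, x * y = p ∧ x ^ 2 = q ∧ y ^ 2 = r := by
    intro p q r hq hr hp
    rcases le_total 0 p with h0 | h0
    · refine ⟨√q, √r, ?_, Real.sq_sqrt hq, Real.sq_sqrt hr⟩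
      rw [← Real.sqrt_mul hq, ← hp, Real.sqrt_sq h0]
    · refine ⟨√q, -√r, ?_, Real.sq_sqrt hq, by rw [neg_sq, Real.sq_sqrt hr]⟩
      rw [mul_neg, ← Real.sqrt_mul hq, ← hp, Real.sqrt_sq_eq_abs, abs_of_nonpos h0, neg_neg]
  have hp : (1 - n.1 0 0) ^ 2 = n.1 0 1 * -n.1 1 0 := by
    rw [show n.1 1 1 = 2 - n.1 0 0 by linarith] at hd
    linear_combination -hd
  have hpos : 0 ≤ n.1 0 1 * -n.1 1 0 := hp ▸ sq_nonneg _
  -- The entries to be written as `x²` and `y²` have the same sign; inversion flips both, which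
  -- decides between `n` and `n⁻¹`.
  have hsign : (0 ≤ n.1 0 1 ∧ 0 ≤ -n.1 1 0) ∨ (0 ≤ -n.1 0 1 ∧ 0 ≤ n.1 1 0) := by
    rcases mul_nonneg_iff.1 hpos with h | h
    · exact Or.inl h
    · exact Or.inr ⟨by linarith [h.1], by linarith [h.2]⟩
  rcases hsign with ⟨h1, h2⟩ | ⟨h1, h2⟩
  · obtain ⟨x, y, e1, e2, e3⟩ := key _ _ _ h1 h2 hp
    refine ⟨x, y, Or.inl ?_⟩
    apply sl_ext <;> simp [unip] <;> linarith
  · obtain ⟨x, y, e1, e2, e3⟩ := key (n.1 0 0 - 1) _ _ h1 h2 (by linarith)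
    refine ⟨x, y, Or.inr ?_⟩
    apply sl_ext <;> simp only [inv_val] <;> simp [unip] <;> linarith

/-- The matrix `k(θ)` in `SL₂(ℝ)`. -/
def kSL (θ : ℝ) : SL(2, ℝ) :=
  ⟨!![Real.cos θ, Real.sin θ; -Real.sin θ, Real.cos θ], by
    rw [Matrix.det_fin_two_of]; nlinarith [Real.sin_sq_add_cos_sq θ]⟩

theorem kSL_val (θ : ℝ) :
    (kSL θ).1 = !![Real.cos θ, Real.sin θ; -Real.sin θ, Real.cos θ] := rfl

theorem exists_polar (a c : ℝ) : ∃ θ : ℝ, |θ| ≤ Real.pi ∧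
    a = √(a ^ 2 + c ^ 2) * Real.cos θ ∧ c = √(a ^ 2 + c ^ 2) * Real.sin θ := by
  have e : ‖(⟨a, c⟩ : ℂ)‖ = √(a ^ 2 + c ^ 2) := by
    rw [Complex.norm_def, Complex.normSq_mk]; congr 1; ring
  refine ⟨Complex.arg ⟨a, c⟩, Complex.abs_arg_le_pi _, ?_, ?_⟩
  · rw [← e, Complex.norm_mul_cos_arg]
  · rw [← e, Complex.norm_mul_sin_arg]

/-- Gram–Schmidt on the columns. The first column of `k(θ)` is `(cos θ, -sin θ)`, so `θ` is the
argument of `(a, -c)`. -/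
theorem iwasawa (g : SL(2, ℝ)) : ∃ θ : ℝ, |θ| ≤ Real.pi ∧
    g = kSL θ * aExpSL (Real.log (g.1 0 0 ^ 2 + g.1 1 0 ^ 2)) *
      hSL ((g.1 0 0 * g.1 0 1 + g.1 1 0 * g.1 1 1) / (g.1 0 0 ^ 2 + g.1 1 0 ^ 2)) := by
  have hd := det_eq g
  obtain ⟨θ, hθ, hc, hs⟩ := exists_polar (g.1 0 0) (-g.1 1 0)
  have hpos : 0 < g.1 0 0 ^ 2 + g.1 1 0 ^ 2 := by
    by_contra hn
    have h1 : g.1 0 0 = 0 := by nlinarith [sq_nonneg (g.1 0 0), sq_nonneg (g.1 1 0)]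
    have h2 : g.1 1 0 = 0 := by nlinarith [sq_nonneg (g.1 0 0), sq_nonneg (g.1 1 0)]
    rw [h1, h2] at hd; norm_num at hd
  rw [neg_sq] at hc hs
  refine ⟨θ, hθ, ?_⟩
  set a := g.1 0 0
  set b := g.1 0 1
  set c := g.1 1 0
  set d := g.1 1 1
  have e1 : Real.exp (Real.log (a ^ 2 + c ^ 2) / 2) = √(a ^ 2 + c ^ 2) := by
    rw [Real.exp_half, Real.exp_log hpos]
  have hρ := Real.sqrt_pos.2 hpos
  have hρ2 := Real.sq_sqrt hpos.le
  set ρ := √(a ^ 2 + c ^ 2)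
  have hcos : Real.cos θ = a / ρ := by rw [eq_div_iff hρ.ne']; linarith
  have hsin : Real.sin θ = -c / ρ := by rw [eq_div_iff hρ.ne']; linarith
  rw [← hρ2]
  have e1' : Real.exp (Real.log (ρ ^ 2) / 2) = ρ := by rw [hρ2]; exact e1
  apply sl_ext <;> simp only [mul_val, kSL_val, aExpSL_val, hSL_val, Real.exp_neg, e1', hcos, hsin,
    Matrix.of_apply, Matrix.cons_val', Matrix.cons_val_zero, Matrix.cons_val_one,
    Matrix.cons_val_fin_one] <;>
    field_simp
  · change a * _ = _; ring
  · change b * _ = _; linear_combination b * ρ * hρ2 - c * ρ * hd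
  · change c * _ = _; ring
  · change d * _ = _; linear_combination d * ρ * hρ2 + a * ρ * hd

/-! ### Lengths of curves -/

theorem lieNorm_nonneg (A : Matrix (Fin 2) (Fin 2) ℝ) : 0 ≤ lieNorm A := Real.sqrt_nonneg _

theorem lieNorm_smul (c : ℝ) (A : Matrix (Fin 2) (Fin 2) ℝ) : lieNorm (c • A) = |c| * lieNorm A := by
  unfold lieNorm
  rw [← Real.sqrt_sq_eq_abs, ← Real.sqrt_mul (sq_nonneg c)]
  congr 1
  simp only [Matrix.smul_apply, smul_eq_mul]
  ring

theorem continuous_lieNorm : Continuous lieNorm := by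
  unfold lieNorm; fun_prop

/-- The entrywise derivative of a curve. -/
def velocity (γ : ℝ → SL(2, ℝ)) (t : ℝ) : Matrix (Fin 2) (Fin 2) ℝ :=
  Matrix.of fun i j => deriv (fun s => (γ s).1 i j) t

theorem bodyVelocity_eq (γ : ℝ → SL(2, ℝ)) (t : ℝ) :
    bodyVelocity γ t = ((γ t)⁻¹).1 * velocity γ t := rfl

theorem IsC1Curve.differentiableAt {γ : ℝ → SL(2, ℝ)} (hγ : IsC1Curve γ) (t : ℝ) (i j : Fin 2) :
    DifferentiableAt ℝ (fun s => (γ s).1 i j) t :=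
  ((hγ i j).differentiable one_ne_zero) t

theorem IsC1Curve.continuous_bodyVelocity {γ : ℝ → SL(2, ℝ)} (hγ : IsC1Curve γ) :
    Continuous (bodyVelocity γ) := by
  have h1 : Continuous fun t => (γ t).1 :=
    continuous_matrix fun i j => (hγ i j).continuous
  have h2 : Continuous (velocity γ) :=
    continuous_matrix fun i j => (hγ i j).continuous_deriv le_rfl
  have h3 : Continuous fun t => ((γ t)⁻¹).1 := by
    simp only [Matrix.SpecialLinearGroup.coe_inv]
    exact h1.matrix_adjugate
  exact h3.matrix_mul h2

theorem bodyVelocity_congr {γ₁ γ₂ : ℝ → SL(2, ℝ)} {t : ℝ} (h : γ₁ =ᶠ[nhds t] γ₂) :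
    bodyVelocity γ₁ t = bodyVelocity γ₂ t := by
  rw [bodyVelocity_eq, bodyVelocity_eq, h.eq_of_nhds]
  congr 1
  ext i j
  exact Filter.EventuallyEq.deriv_eq (h.mono fun s hs => by simp only [hs])

theorem bodyVelocity_mul_left (m : SL(2, ℝ)) {γ : ℝ → SL(2, ℝ)} (hγ : IsC1Curve γ) (t : ℝ) :
    bodyVelocity (fun s => m * γ s) t = bodyVelocity γ t := by
  have e : velocity (fun s => m * γ s) t = m.1 * velocity γ t := by
    ext i j
    simp only [velocity, Matrix.of_apply, Matrix.mul_apply, Fin.sum_univ_two,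
      Matrix.SpecialLinearGroup.coe_mul]
    rw [deriv_fun_add, deriv_const_mul_field, deriv_const_mul_field]
    · exact (hγ.differentiableAt t 0 j).const_mul _
    · exact (hγ.differentiableAt t 1 j).const_mul _
  rw [bodyVelocity_eq, bodyVelocity_eq, e, ← Matrix.mul_assoc,
    ← Matrix.SpecialLinearGroup.coe_mul]
  simp

theorem bodyVelocity_comp {γ : ℝ → SL(2, ℝ)} (hγ : IsC1Curve γ) {φ : ℝ → ℝ} {t : ℝ}
    (hφ : DifferentiableAt ℝ φ t) :
    bodyVelocity (fun s => γ (φ s)) t = deriv φ t • bodyVelocity γ (φ t) := by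
  have e : velocity (fun s => γ (φ s)) t = deriv φ t • velocity γ (φ t) := by
    ext i j
    simp only [velocity, Matrix.of_apply, Matrix.smul_apply, smul_eq_mul]
    have := deriv_comp t (h₂ := fun s => (γ s).1 i j) (hγ.differentiableAt (φ t) i j) hφ
    simp only [Function.comp_def] at this
    rw [this, mul_comm]
  rw [bodyVelocity_eq, bodyVelocity_eq, e, Matrix.mul_smul]

theorem IsC1Curve.comp {γ : ℝ → SL(2, ℝ)} (hγ : IsC1Curve γ) {φ : ℝ → ℝ} (hφ : ContDiff ℝ 1 φ) :
    IsC1Curve fun s => γ (φ s) := fun i j => (hγ i j).comp hφ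

theorem IsC1Curve.mul {γ₁ γ₂ : ℝ → SL(2, ℝ)} (h₁ : IsC1Curve γ₁) (h₂ : IsC1Curve γ₂) :
    IsC1Curve fun s => γ₁ s * γ₂ s := fun i j => by
  simp only [Matrix.SpecialLinearGroup.coe_mul, Matrix.mul_apply, Fin.sum_univ_two]
  exact ((h₁ i 0).mul (h₂ 0 j)).add ((h₁ i 1).mul (h₂ 1 j))

theorem isC1Curve_const (m : SL(2, ℝ)) : IsC1Curve fun _ => m := fun _ _ => contDiff_const

theorem curveLength_nonneg (γ : ℝ → SL(2, ℝ)) : 0 ≤ curveLength γ :=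
  intervalIntegral.integral_nonneg zero_le_one fun _ _ => lieNorm_nonneg _

theorem integral_lieNorm_comp {γ : ℝ → SL(2, ℝ)} (hγ : IsC1Curve γ) {φ : ℝ → ℝ}
    (hφ : ContDiff ℝ 1 φ) (hmono : Monotone φ) (a b : ℝ) :
    ∫ t in a..b, lieNorm (bodyVelocity (fun s => γ (φ s)) t) =
      ∫ t in φ a..φ b, lieNorm (bodyVelocity γ t) := by
  rw [← intervalIntegral.integral_comp_mul_deriv (f := φ) (f' := deriv φ)]
  · refine intervalIntegral.integral_congr fun t _ => ?_
    simp only [Function.comp_apply]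
    rw [bodyVelocity_comp hγ (hφ.differentiable one_ne_zero t), lieNorm_smul,
      abs_of_nonneg hmono.deriv_nonneg, mul_comm]
  · exact fun x _ => (hφ.differentiable one_ne_zero x).hasDerivAt
  · exact (hφ.continuous_deriv le_rfl).continuousOn
  · exact continuous_lieNorm.comp hγ.continuous_bodyVelocity

/-- `g₁` and `g₂` are joined by a curve of length at most `L`. -/
def Joins (g₁ g₂ : PSL2R) (L : ℝ) : Prop :=
  ∃ γ : ℝ → SL(2, ℝ), IsC1Curve γ ∧ proj (γ 0) = g₁ ∧ proj (γ 1) = g₂ ∧ curveLength γ ≤ L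

theorem Joins.mono {g₁ g₂ : PSL2R} {L L' : ℝ} (h : Joins g₁ g₂ L) (hL : L ≤ L') :
    Joins g₁ g₂ L' := by
  obtain ⟨γ, h1, h2, h3, h4⟩ := h
  exact ⟨γ, h1, h2, h3, h4.trans hL⟩

/-- To keep the concatenation `C¹`, both curves are slowed down to rest at the junction by
`Real.smoothTransition`. The lifts agree there only up to sign, so the second curve is translated on
the left; in the product, one factor is constant on each half. -/
theorem Joins.trans {g₁ g₂ g₃ : PSL2R} {L L' : ℝ} (h : Joins g₁ g₂ L) (h' : Joins g₂ g₃ L') :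
    Joins g₁ g₃ (L + L') := by
  obtain ⟨γ₁, h1, h2, h3, h4⟩ := h
  obtain ⟨γ₂, k1, k2, k3, k4⟩ := h'
  have hst : ContDiff ℝ 1 Real.smoothTransition := Real.smoothTransition.contDiff (n := 1)
  set φ₁ : ℝ → ℝ := fun t => Real.smoothTransition (2 * t) with hφ₁
  set φ₂ : ℝ → ℝ := fun t => Real.smoothTransition (2 * t - 1) with hφ₂
  have c1 : ContDiff ℝ 1 φ₁ := hst.comp (contDiff_const.mul contDiff_id)
  have c2 : ContDiff ℝ 1 φ₂ := hst.comp ((contDiff_const.mul contDiff_id).sub contDiff_const)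
  have m1 : Monotone φ₁ := fun s t hs => Real.smoothTransition.monotone (by linarith)
  have m2 : Monotone φ₂ := fun s t hs => Real.smoothTransition.monotone (by linarith)
  have z1 : φ₁ 0 = 0 := by simp [hφ₁]
  have z1' : ∀ t, 1 / 2 ≤ t → φ₁ t = 1 := fun t ht =>
    Real.smoothTransition.one_of_one_le (by linarith)
  have z2 : ∀ t, t ≤ 1 / 2 → φ₂ t = 0 := fun t ht =>
    Real.smoothTransition.zero_of_nonpos (by linarith)
  have z2' : φ₂ 1 = 1 := Real.smoothTransition.one_of_one_le (by norm_num)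
  set δ₁ : ℝ → SL(2, ℝ) := fun s => γ₁ (φ₁ s)
  set δ₂ : ℝ → SL(2, ℝ) := fun s => γ₂ (φ₂ s)
  have d1 : IsC1Curve δ₁ := h1.comp c1
  have d2 : IsC1Curve δ₂ := k1.comp c2
  set δ : ℝ → SL(2, ℝ) := fun s => δ₁ s * (γ₂ 0)⁻¹ * δ₂ s with hδ
  have dc : IsC1Curve δ := (d1.mul (isC1Curve_const _)).mul d2
  refine ⟨δ, dc, ?_, ?_, ?_⟩
  · simp only [hδ, δ₁, δ₂, z1, z2 0 (by norm_num)]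
    simpa using h2
  · simp only [hδ, δ₁, δ₂, z1' 1 (by norm_num), z2']
    have : proj (γ₁ 1 * (γ₂ 0)⁻¹ * γ₂ 1) = proj (γ₁ 1) * (proj (γ₂ 0))⁻¹ * proj (γ₂ 1) := rfl
    rw [this, h3, k2, k3]; simp
  · have hcont : Continuous fun t => lieNorm (bodyVelocity δ t) :=
      continuous_lieNorm.comp dc.continuous_bodyVelocity
    have e1 : ∫ t in (0 : ℝ)..(1 / 2), lieNorm (bodyVelocity δ t) = curveLength γ₁ := by
      have : ∫ t in (0 : ℝ)..(1 / 2), lieNorm (bodyVelocity δ t) =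
          ∫ t in (0 : ℝ)..(1 / 2), lieNorm (bodyVelocity δ₁ t) := by
        refine intervalIntegral.integral_congr_ae ?_
        filter_upwards [MeasureTheory.Measure.ae_ne MeasureTheory.volume (1 / 2 : ℝ)] with t ht hmem
        rw [Set.uIoc_of_le (by norm_num)] at hmem
        have hlt : t < 1 / 2 := lt_of_le_of_ne hmem.2 ht
        rw [bodyVelocity_congr (γ₂ := δ₁)]
        filter_upwards [Iio_mem_nhds hlt] with s hs
        simp only [hδ, δ₂, z2 s (le_of_lt hs)]
        group
      rw [this, integral_lieNorm_comp h1 c1 m1, z1, z1' _ le_rfl]; rfl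
    have e2 : ∫ t in (1 / 2 : ℝ)..1, lieNorm (bodyVelocity δ t) = curveLength γ₂ := by
      have : ∫ t in (1 / 2 : ℝ)..1, lieNorm (bodyVelocity δ t) =
          ∫ t in (1 / 2 : ℝ)..1, lieNorm (bodyVelocity δ₂ t) := by
        refine intervalIntegral.integral_congr_ae ?_
        filter_upwards with t hmem
        rw [Set.uIoc_of_le (by norm_num)] at hmem
        rw [bodyVelocity_congr (γ₂ := fun s => γ₁ 1 * (γ₂ 0)⁻¹ * δ₂ s),
          bodyVelocity_mul_left _ d2]
        filter_upwards [Ioi_mem_nhds hmem.1] with s hs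
        simp only [hδ, δ₁, z1' s (le_of_lt hs)]
      rw [this, integral_lieNorm_comp k1 c2 m2, z2 _ le_rfl, z2']; rfl
    rw [curveLength, ← intervalIntegral.integral_add_adjacent_intervals
      (hcont.intervalIntegrable 0 (1 / 2)) (hcont.intervalIntegrable (1 / 2) 1), e1, e2]
    linarith

theorem Joins.mul_left {g₁ g₂ : PSL2R} {L : ℝ} (h : Joins g₁ g₂ L) (m : SL(2, ℝ)) :
    Joins (proj m * g₁) (proj m * g₂) L := by
  obtain ⟨γ, h1, rfl, rfl, h4⟩ := h
  refine ⟨fun s => m * γ s, (isC1Curve_const m).mul h1, rfl, rfl, ?_⟩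
  simpa only [curveLength, bodyVelocity_mul_left m h1] using h4

theorem dG_le {g₁ g₂ : PSL2R} {L : ℝ} (h : Joins g₁ g₂ L) : dG g₁ g₂ ≤ L := by
  obtain ⟨γ, h1, h2, h3, h4⟩ := h
  have hmem : curveLength γ ∈ {L : ℝ | ∃ γ : ℝ → SL(2, ℝ), IsC1Curve γ ∧ proj (γ 0) = g₁ ∧
      proj (γ 1) = g₂ ∧ L = curveLength γ} := ⟨γ, h1, h2, h3, rfl⟩
  refine (csInf_le ⟨0, ?_⟩ hmem).trans h4
  rintro _ ⟨γ, -, -, -, rfl⟩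
  exact curveLength_nonneg γ

theorem dG_nonneg (g₁ g₂ : PSL2R) : 0 ≤ dG g₁ g₂ := by
  refine Real.sInf_nonneg ?_
  rintro _ ⟨γ, -, -, -, rfl⟩
  exact curveLength_nonneg γ

/-- The hypothesis says that `N = (p q; r -p)` has square zero, so `s ↦ 1 + s N` is a one-parameter
group of constant body velocity `N`. -/
theorem joins_nilpotent (p q r : ℝ) (hpq : p ^ 2 + q * r = 0) (m : SL(2, ℝ))
    (hm : m.1 = !![1 + p, q; r, 1 - p]) :
    Joins (proj 1) (proj m) (√((q + r) ^ 2 + (2 * p) ^ 2 + r ^ 2)) := by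
  set γ : ℝ → SL(2, ℝ) := fun s => ⟨!![1 + s * p, s * q; s * r, 1 - s * p], by
    rw [Matrix.det_fin_two_of]; linear_combination (-s ^ 2) * hpq⟩ with hγ
  have hc : IsC1Curve γ := by
    intro i j
    fin_cases i <;> fin_cases j <;> simp [hγ] <;> fun_prop
  have e : ∀ t, bodyVelocity γ t = !![p, q; r, -p] := by
    intro t
    have hv : velocity γ t = !![p, q; r, -p] := by
      ext i j
      fin_cases i <;> fin_cases j <;> simp [velocity, hγ]
    rw [bodyVelocity_eq, hv, inv_val]
    ext i j
    fin_cases i <;> fin_cases j <;> simp [hγ, Matrix.mul_apply, Fin.sum_univ_two]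
    · linear_combination (-t) * hpq
    · ring
    · ring
    · linear_combination (-t) * hpq
  refine ⟨γ, hc, ?_, ?_, ?_⟩
  · congr 1; apply sl_ext <;> simp [hγ]
  · congr 1; apply sl_ext <;> simp [hγ, hm]
  · simp [curveLength, e, lieNorm]

theorem joins_hSL (x : ℝ) : Joins (proj 1) (proj (hSL x)) |x| := by
  have := joins_nilpotent 0 x 0 (by ring) (hSL x) (by simp [hSL_val])
  simpa [Real.sqrt_sq_eq_abs] using this

theorem joins_aExpSL (u : ℝ) : Joins (proj 1) (proj (aExpSL u)) |u| := by
  set γ : ℝ → SL(2, ℝ) := fun s => aExpSL (s * u) with hγ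
  have hc : IsC1Curve γ := by
    intro i j
    fin_cases i <;> fin_cases j <;> simp [hγ, aExpSL_val] <;> fun_prop
  have e : ∀ t, bodyVelocity γ t = !![u / 2, 0; 0, -(u / 2)] := by
    intro t
    have d1 : HasDerivAt (fun s : ℝ => Real.exp (s * u / 2)) (Real.exp (t * u / 2) * (u / 2)) t := by
      have := (((hasDerivAt_id t).mul_const u).div_const 2).exp
      simpa using this
    have d2 : HasDerivAt (fun s : ℝ => Real.exp (-(s * u / 2)))
        (Real.exp (-(t * u / 2)) * -(u / 2)) t := by
      have := (((hasDerivAt_id t).mul_const u).div_const 2).neg.exp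
      simpa using this
    have hv : velocity γ t = !![Real.exp (t * u / 2) * (u / 2), 0; 0,
        Real.exp (-(t * u / 2)) * -(u / 2)] := by
      ext i j
      fin_cases i <;> fin_cases j <;> simp [velocity, hγ, aExpSL_val, d1.deriv, d2.deriv]
    have hexp : Real.exp (-(t * u / 2)) * Real.exp (t * u / 2) = 1 := by
      rw [← Real.exp_add]; simp
    rw [bodyVelocity_eq, hv, inv_val]
    ext i j
    fin_cases i <;> fin_cases j <;> simp [hγ, aExpSL_val, Matrix.mul_apply, Fin.sum_univ_two]
    · linear_combination (u / 2) * hexp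
    · linear_combination (u / 2) * hexp
  refine ⟨γ, hc, ?_, ?_, ?_⟩
  · congr 1; apply sl_ext <;> simp [hγ, aExpSL_val]
  · simp [hγ]
  · simp only [curveLength, e, lieNorm]
    simp [Real.sqrt_sq_eq_abs, mul_div_cancel₀]

theorem joins_kSL (θ : ℝ) : Joins (proj 1) (proj (kSL θ)) |θ| := by
  set γ : ℝ → SL(2, ℝ) := fun s => kSL (s * θ) with hγ
  have hc : IsC1Curve γ := by
    intro i j
    fin_cases i <;> fin_cases j <;> simp [hγ, kSL_val] <;> fun_prop
  have e : ∀ t, bodyVelocity γ t = !![0, θ; -θ, 0] := by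
    intro t
    have d1 : HasDerivAt (fun s : ℝ => Real.cos (s * θ)) (-Real.sin (t * θ) * θ) t := by
      simpa using ((hasDerivAt_id t).mul_const θ).cos
    have d2 : HasDerivAt (fun s : ℝ => Real.sin (s * θ)) (Real.cos (t * θ) * θ) t := by
      simpa using ((hasDerivAt_id t).mul_const θ).sin
    have hv : velocity γ t = !![-Real.sin (t * θ) * θ, Real.cos (t * θ) * θ;
        -(Real.cos (t * θ) * θ), -Real.sin (t * θ) * θ] := by
      ext i j
      fin_cases i <;> fin_cases j <;> simp [velocity, hγ, kSL_val, d1.deriv, d2.deriv]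
    have h1 := Real.sin_sq_add_cos_sq (t * θ)
    rw [bodyVelocity_eq, hv, inv_val]
    ext i j
    fin_cases i <;> fin_cases j <;> simp [hγ, kSL_val, Matrix.mul_apply, Fin.sum_univ_two]
    · ring
    · linear_combination θ * h1
    · linear_combination (-θ) * h1
    · ring
  refine ⟨γ, hc, ?_, ?_, ?_⟩
  · congr 1; apply sl_ext <;> simp [hγ, kSL_val]
  · simp [hγ]
  · simp only [curveLength, e, lieNorm]
    simp [Real.sqrt_sq_eq_abs]

theorem Joins.mul {u v : SL(2, ℝ)} {L L' : ℝ} (hu : Joins (proj 1) (proj u) L)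
    (hv : Joins (proj 1) (proj v) L') : Joins (proj 1) (proj (u * v)) (L + L') := by
  have h2 : Joins (proj (u * 1)) (proj (u * v)) L' := hv.mul_left u
  rw [mul_one] at h2
  exact hu.trans h2

/-- Elements of bounded Frobenius norm are at bounded distance from the identity. -/
theorem joins_of_nsq_le {u : SL(2, ℝ)} {R : ℝ} (hu : nsq u.1 ≤ R) :
    Joins (proj 1) (proj u) (4 + R + R ^ 2) := by
  obtain ⟨θ, hθ, e⟩ := iwasawa u
  have hd := det_eq u
  have hR : 0 ≤ R := (nsq_nonneg _).trans hu
  have h2 := two_le_nsq u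
  unfold nsq at hu h2
  set a := u.1 0 0
  set b := u.1 0 1
  set c := u.1 1 0
  set d := u.1 1 1
  -- Lagrange's identity with determinant one bounds the first column away from zero, hence the
  -- logarithm from below.
  have hcs : 1 ≤ (a ^ 2 + c ^ 2) * (b ^ 2 + d ^ 2) := by
    nlinarith [sq_nonneg (a * b + c * d), sq_nonneg (a * d - b * c)]
  have hbd : b ^ 2 + d ^ 2 ≤ R := by nlinarith
  have hac : a ^ 2 + c ^ 2 ≤ R := by nlinarith
  have hpos : 0 < a ^ 2 + c ^ 2 := by
    by_contra hn
    have : a ^ 2 + c ^ 2 = 0 := by nlinarith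
    rw [this] at hcs; norm_num at hcs
  have hRpos : 0 < R := hpos.trans_le hac
  have hlow : 1 ≤ (a ^ 2 + c ^ 2) * R := hcs.trans (mul_le_mul_of_nonneg_left hbd hpos.le)
  have hlog : |Real.log (a ^ 2 + c ^ 2)| ≤ R := by
    have h3 := Real.log_le_sub_one_of_pos hRpos
    have h4 := Real.log_le_log hpos hac
    have h5 := Real.log_nonneg hlow
    rw [Real.log_mul hpos.ne' hRpos.ne'] at h5
    rw [abs_le]; constructor <;> linarith
  have hx : |(a * b + c * d) / (a ^ 2 + c ^ 2)| ≤ R ^ 2 := by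
    rw [abs_div, abs_of_pos hpos, div_le_iff₀ hpos]
    have h6 : |a * b + c * d| ≤ R := by
      rw [abs_le]; constructor <;>
        nlinarith [sq_nonneg (a + b), sq_nonneg (c + d), sq_nonneg (a - b), sq_nonneg (c - d)]
    nlinarith
  have := ((joins_kSL θ).mul (joins_aExpSL (Real.log (a ^ 2 + c ^ 2)))).mul
    (joins_hSL ((a * b + c * d) / (a ^ 2 + c ^ 2)))
  rw [← e] at this
  exact this.mono (by linarith [Real.pi_le_four])

theorem dG_mul_le {g : PSL2R} {u : SL(2, ℝ)} {L : ℝ} (h : Joins (proj 1) (proj u) L) :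
    dG g (g * proj u) ≤ L := by
  obtain ⟨m, rfl⟩ := QuotientGroup.mk_surjective g
  have := h.mul_left m
  rw [show proj m * proj 1 = proj m from mul_one _] at this
  exact dG_le this

theorem exists_joins_lt {g₁ g₂ : PSL2R} {D : ℝ} (h : dG g₁ g₂ < D) : Joins g₁ g₂ D := by
  obtain ⟨m₁, rfl⟩ := QuotientGroup.mk_surjective g₁
  obtain ⟨m₂, rfl⟩ := QuotientGroup.mk_surjective g₂
  -- The infimum defining `dG` is meaningful only once some curve joins the points.
  have hne := (joins_of_nsq_le (u := m₁⁻¹ * m₂) le_rfl).mul_left m₁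
  obtain ⟨γ, h1, h2, h3, -⟩ := hne
  have e1 : proj m₁ * proj 1 = proj m₁ := mul_one _
  have e2 : proj m₁ * proj (m₁⁻¹ * m₂) = proj m₂ := by
    change proj (m₁ * (m₁⁻¹ * m₂)) = _; rw [mul_inv_cancel_left]
  rw [e1] at h2; rw [e2] at h3
  have hmem : curveLength γ ∈ {L : ℝ | ∃ γ : ℝ → SL(2, ℝ), IsC1Curve γ ∧ proj (γ 0) = proj m₁ ∧
      proj (γ 1) = proj m₂ ∧ L = curveLength γ} := ⟨γ, h1, h2, h3, rfl⟩
  obtain ⟨_, ⟨γ', k1, k2, k3, rfl⟩, hlt⟩ := exists_lt_of_csInf_lt ⟨_, hmem⟩ h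
  exact ⟨γ', k1, k2, k3, hlt.le⟩

/-- The left side is the derivative of `|w|²` when `w' = -(p q; r -p) w`. Only the symmetric part of
the matrix contributes. The constant one in front of the norm matters: it fixes the exponent in `exp
(-d)`. -/
theorem growth_bound (p q r w₁ w₂ : ℝ) : -2 * (p * (w₁ ^ 2 - w₂ ^ 2) + (q + r) * (w₁ * w₂)) ≤
    √((q + r) ^ 2 + (2 * p) ^ 2 + r ^ 2) * (w₁ ^ 2 + w₂ ^ 2) := by
  refine le_of_sq_le_sq ?_ (by positivity)
  rw [mul_pow √_, Real.sq_sqrt (by positivity)]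
  nlinarith [sq_nonneg (2 * p * (2 * (w₁ * w₂)) - (q + r) * (w₁ ^ 2 - w₂ ^ 2)),
    sq_nonneg (r * (w₁ ^ 2 + w₂ ^ 2))]

/-- Along a curve of length `L`, the norm of a vector in the moving frame grows by a factor of at
most `exp (L / 2)`. -/
theorem Joins.norm_growth {g₁ g₂ : PSL2R} {L : ℝ} (h : Joins g₁ g₂ L) :
    ∃ m₁ m₂ : SL(2, ℝ), proj m₁ = g₁ ∧ proj m₂ = g₂ ∧ ∀ x y : ℝ,
      ((m₂⁻¹ * m₁).1 0 0 * x + (m₂⁻¹ * m₁).1 0 1 * y) ^ 2 +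
        ((m₂⁻¹ * m₁).1 1 0 * x + (m₂⁻¹ * m₁).1 1 1 * y) ^ 2 ≤ Real.exp L * (x ^ 2 + y ^ 2) := by
  obtain ⟨γ, h1, h2, h3, h4⟩ := h
  refine ⟨γ 0, γ 1, h2, h3, ?_⟩
  have key : ∀ x y : ℝ, ((γ 1).1 1 1 * x - (γ 1).1 0 1 * y) ^ 2 +
      (-(γ 1).1 1 0 * x + (γ 1).1 0 0 * y) ^ 2 ≤ Real.exp L *
      (((γ 0).1 1 1 * x - (γ 0).1 0 1 * y) ^ 2 + (-(γ 0).1 1 0 * x + (γ 0).1 0 0 * y) ^ 2) := by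
    intro x y
    -- `f t` is `|γ(t)⁻¹ v|²`. The vector `γ⁻¹ v` has derivative `-B γ⁻¹ v`, with `B` the body
    -- velocity, so Grönwall's argument applies with rate `ℓ`.
    set f : ℝ → ℝ := fun t => ((γ t).1 1 1 * x - (γ t).1 0 1 * y) ^ 2 +
      (-(γ t).1 1 0 * x + (γ t).1 0 0 * y) ^ 2 with hf
    set ℓ : ℝ → ℝ := fun t => lieNorm (bodyVelocity γ t) with hℓ
    have hℓc : Continuous ℓ := continuous_lieNorm.comp h1.continuous_bodyVelocity
    set Λ : ℝ → ℝ := fun t => ∫ s in (0 : ℝ)..t, ℓ s with hΛ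
    have hΛd : ∀ t, HasDerivAt Λ (ℓ t) t := fun t =>
      intervalIntegral.integral_hasDerivAt_right (hℓc.intervalIntegrable 0 t)
        (hℓc.stronglyMeasurableAtFilter _ _) hℓc.continuousAt
    have hfd : ∀ t, ∃ f', HasDerivAt f f' t ∧ f' ≤ ℓ t * f t := by
      intro t
      have da := (h1.differentiableAt t 0 0).hasDerivAt
      have db := (h1.differentiableAt t 0 1).hasDerivAt
      have dc := (h1.differentiableAt t 1 0).hasDerivAt
      have dd := (h1.differentiableAt t 1 1).hasDerivAt
      have hdet := (da.mul dd).sub (db.mul dc)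
      have hone : ((fun s => (γ s).1 0 0) * (fun s => (γ s).1 1 1) -
          (fun s => (γ s).1 0 1) * fun s => (γ s).1 1 0) = fun _ => (1 : ℝ) :=
        funext fun s => det_eq (γ s)
      rw [hone] at hdet
      -- The derivative of the determinant vanishes: the body velocity has trace zero.
      have htr := hdet.unique (hasDerivAt_const t (1 : ℝ))
      have hdt := det_eq (γ t)
      have hfd := (((dd.mul_const x).sub (db.mul_const y)).pow 2).add
        (((dc.neg.mul_const x).add (da.mul_const y)).pow 2)
      refine ⟨_, hfd, ?_⟩
      have hB : bodyVelocity γ t = ((γ t)⁻¹).1 * velocity γ t := rfl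
      simp only [hℓ, hf, lieNorm, hB, inv_val, Matrix.mul_apply, Fin.sum_univ_two, velocity,
        Matrix.of_apply, Matrix.cons_val', Matrix.cons_val_zero, Matrix.cons_val_one,
        Matrix.cons_val_fin_one, Pi.sub_apply, Pi.add_apply, Pi.neg_apply]
      set a := (γ t).1 0 0
      set b := (γ t).1 0 1
      set c := (γ t).1 1 0
      set d := (γ t).1 1 1
      set a' := deriv (fun s => (γ s).1 0 0) t
      set b' := deriv (fun s => (γ s).1 0 1) t
      set c' := deriv (fun s => (γ s).1 1 0) t
      set d' := deriv (fun s => (γ s).1 1 1) t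
      set p := d * a' + -b * c' with hp
      set q := d * b' + -b * d' with hq
      set r := -c * a' + a * c' with hr
      have e1 : d' * x - b' * y = -(p * (d * x - b * y) + q * (-c * x + a * y)) := by
        rw [hp, hq]
        linear_combination (d' * x - b' * y) * hdt * (-1) +
          (d * x - b * y) * htr
      have e2 : -c' * x + a' * y = -(r * (d * x - b * y) - p * (-c * x + a * y)) := by
        rw [hp, hr]
        linear_combination (-c' * x + a' * y) * hdt * (-1)
      set w₁ := d * x - b * y
      set w₂ := -c * x + a * y
      have hb := growth_bound p q r w₁ w₂
      refine le_of_eq_of_le ?_ hb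
      simp only [Nat.cast_ofNat, Nat.add_one_sub_one, pow_one]
      linear_combination 2 * w₁ * e1 + 2 * w₂ * e2
    have hmono : Antitone fun t => f t * Real.exp (-Λ t) := by
      refine antitone_of_deriv_nonpos ?_ ?_
      · intro t
        obtain ⟨f', hf', -⟩ := hfd t
        exact (hf'.mul (hΛd t).neg.exp).differentiableAt
      · intro t
        obtain ⟨f', hf', hle⟩ := hfd t
        refine (hf'.mul (hΛd t).neg.exp).deriv.trans_le ?_
        simp only [Pi.neg_apply]
        have := Real.exp_pos (-Λ t)
        nlinarith
    have h01 := hmono zero_le_one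
    have hΛ0 : Λ 0 = 0 := by simp [hΛ]
    have hΛ1 : Λ 1 ≤ L := h4
    simp only [hΛ0, neg_zero, Real.exp_zero, mul_one] at h01
    change f 1 ≤ Real.exp L * f 0
    have hf0 : 0 ≤ f 0 := by simp only [hf]; positivity
    calc f 1 = (f 1 * Real.exp (-Λ 1)) * Real.exp (Λ 1) := by
          rw [mul_assoc, ← Real.exp_add]; simp
      _ ≤ f 0 * Real.exp (Λ 1) := mul_le_mul_of_nonneg_right h01 (Real.exp_pos _).le
      _ ≤ f 0 * Real.exp L := mul_le_mul_of_nonneg_left (Real.exp_le_exp.2 hΛ1) hf0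
      _ = _ := mul_comm _ _
  intro x y
  have hd := det_eq (γ 0)
  have := key ((γ 0).1 0 0 * x + (γ 0).1 0 1 * y) ((γ 0).1 1 0 * x + (γ 0).1 1 1 * y)
  have e1 : (γ 0).1 1 1 * ((γ 0).1 0 0 * x + (γ 0).1 0 1 * y) -
      (γ 0).1 0 1 * ((γ 0).1 1 0 * x + (γ 0).1 1 1 * y) = x := by linear_combination x * hd
  have e2 : -(γ 0).1 1 0 * ((γ 0).1 0 0 * x + (γ 0).1 0 1 * y) +
      (γ 0).1 0 0 * ((γ 0).1 1 0 * x + (γ 0).1 1 1 * y) = y := by linear_combination y * hd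
  rw [e1, e2] at this
  refine le_of_eq_of_le ?_ this
  simp only [mul_val, inv_val, Matrix.of_apply,
    Matrix.cons_val', Matrix.cons_val_zero, Matrix.cons_val_one, Matrix.cons_val_fin_one]
  ring

/-! ### Discrete subgroups -/

/-- The preimage in `SL₂(ℝ)` of a subgroup of `PSL₂(ℝ)`. -/
def lift (Γ : Subgroup PSL2R) : Subgroup SL(2, ℝ) :=
  Γ.comap (QuotientGroup.mk' (Subgroup.center SL(2, ℝ)))

theorem mem_lift {Γ : Subgroup PSL2R} {m : SL(2, ℝ)} : m ∈ lift Γ ↔ proj m ∈ Γ := Iff.rfl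

theorem mem_center_iff' {m : SL(2, ℝ)} : m ∈ Subgroup.center SL(2, ℝ) ↔ m = 1 ∨ m = -1 := by
  rw [Matrix.SpecialLinearGroup.mem_center_iff]
  constructor
  · rintro ⟨r, hr, e⟩
    have h2 : r = 1 ∨ r = -1 := mul_self_eq_one_iff.1 (by simpa [sq] using hr)
    rcases h2 with rfl | rfl
    · left; apply Subtype.ext; rw [← e]; simp
    · right; apply Subtype.ext; rw [← e, map_neg, map_one]; rfl
  · rintro (rfl | rfl)
    · exact ⟨1, by simp, by simp⟩
    · exact ⟨-1, by simp, by rw [map_neg, map_one]; rfl⟩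

theorem proj_neg (m : SL(2, ℝ)) : proj (-m) = proj m := by
  rw [QuotientGroup.eq]
  exact mem_center_iff'.2 (Or.inr (by simp))

theorem proj_eq_iff {m n : SL(2, ℝ)} : proj m = proj n ↔ m = n ∨ m = -n := by
  constructor
  · intro h
    rw [QuotientGroup.eq, mem_center_iff'] at h
    rcases h with h | h
    · left; rw [inv_mul_eq_one] at h; exact h
    · right; rw [inv_mul_eq_iff_eq_mul] at h; rw [h]; simp
  · rintro (rfl | rfl)
    · rfl
    · exact proj_neg n

theorem neg_one_mem_lift (Γ : Subgroup PSL2R) : -1 ∈ lift Γ := by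
  rw [mem_lift, proj_neg]; exact Γ.one_mem

theorem exists_size_lt_of_mem_nhds {V : Set SL(2, ℝ)} (hV : V ∈ nhds (1 : SL(2, ℝ))) :
    ∃ ε > 0, ∀ m : SL(2, ℝ), size m < ε → m ∈ V := by
  obtain ⟨W, hW, hWV⟩ := (mem_nhds_induced Subtype.val (1 : SL(2, ℝ)) V).1 hV
  have hW' : W ∈ nhds (X := Fin 2 → Fin 2 → ℝ) (1 : Matrix (Fin 2) (Fin 2) ℝ) := hW
  obtain ⟨ε, hε, hball⟩ := Metric.mem_nhds_iff.1 hW'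
  refine ⟨ε ^ 2, by positivity, fun m hm => hWV (hball ?_)⟩
  rw [size, nsq] at hm
  have key : ∀ i j, (m.1 i j - (1 : Matrix (Fin 2) (Fin 2) ℝ) i j) ^ 2 < ε ^ 2 := by
    simp only [Matrix.sub_apply] at hm
    intro i j
    have h1 := sq_nonneg (m.1 0 0 - (1 : Matrix (Fin 2) (Fin 2) ℝ) 0 0)
    have h2 := sq_nonneg (m.1 0 1 - (1 : Matrix (Fin 2) (Fin 2) ℝ) 0 1)
    have h3 := sq_nonneg (m.1 1 0 - (1 : Matrix (Fin 2) (Fin 2) ℝ) 1 0)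
    have h4 := sq_nonneg (m.1 1 1 - (1 : Matrix (Fin 2) (Fin 2) ℝ) 1 1)
    revert i j
    simp only [Fin.forall_fin_two]
    refine ⟨⟨?_, ?_⟩, ?_, ?_⟩ <;> linarith
  refine Metric.mem_ball.2 ((dist_pi_lt_iff hε).2 fun i => (dist_pi_lt_iff hε).2 fun j => ?_)
  rw [Real.dist_eq]
  exact abs_lt_of_sq_lt_sq (key i j) hε.le

theorem exists_size_lt_eq_one {Γ : Subgroup PSL2R} (hΓ : DiscreteTopology Γ) :
    ∃ ε > 0, ∀ m ∈ lift Γ, size m < ε → m = 1 := by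
  obtain ⟨U, hU, hU1⟩ := isOpen_induced_iff.1 (isOpen_discrete ({1} : Set Γ))
  have h1 : (1 : PSL2R) ∈ U := by
    have : (1 : Γ) ∈ (Subtype.val ⁻¹' U : Set Γ) := by rw [hU1]; rfl
    exact this
  have hV : (QuotientGroup.mk ⁻¹' U : Set SL(2, ℝ)) ∈ nhds (1 : SL(2, ℝ)) :=
    (hU.preimage QuotientGroup.continuous_mk).mem_nhds h1
  obtain ⟨ε, hε, h⟩ := exists_size_lt_of_mem_nhds hV
  -- The bound by one excludes `-1`, the other preimage of the identity, whose size is 8.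
  refine ⟨min ε 1, by positivity, fun m hm hs => ?_⟩
  have hmU : proj m ∈ U := h m (hs.trans_le (min_le_left _ _))
  have : (⟨proj m, hm⟩ : Γ) ∈ ({1} : Set Γ) := by rw [← hU1]; exact hmU
  have h2 : proj m = proj 1 := congrArg Subtype.val this
  rcases proj_eq_iff.1 h2 with h3 | h3
  · exact h3
  · have := hs.trans_le (min_le_right _ _)
    rw [h3, size_neg_one] at this
    norm_num at this

theorem isCompact_nsq_le (R : ℝ) : IsCompact {m : SL(2, ℝ) | nsq m.1 ≤ R} := by
  have hind : Topology.IsInducing (fun m : SL(2, ℝ) => m.1) := ⟨rfl⟩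
  refine hind.isCompact_iff.2 ?_
  have e : (fun m : SL(2, ℝ) => m.1) '' {m : SL(2, ℝ) | nsq m.1 ≤ R} =
      {A : Matrix (Fin 2) (Fin 2) ℝ | A.det = 1 ∧ nsq A ≤ R} := by
    ext A
    constructor
    · rintro ⟨m, hm, rfl⟩; exact ⟨m.2, hm⟩
    · rintro ⟨h1, h2⟩; exact ⟨⟨A, h1⟩, h2, rfl⟩
  rw [e]
  have hclosed : IsClosed {A : Matrix (Fin 2) (Fin 2) ℝ | A.det = 1 ∧ nsq A ≤ R} :=
    (isClosed_eq (continuous_id.matrix_det) continuous_const).inter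
      (isClosed_le continuous_nsq continuous_const)
  have hsub : {A : Matrix (Fin 2) (Fin 2) ℝ | A.det = 1 ∧ nsq A ≤ R} ⊆
      (Metric.closedBall (α := Fin 2 → Fin 2 → ℝ) 0 (R + 1) : Set (Fin 2 → Fin 2 → ℝ)) := by
    rintro A ⟨-, hA⟩
    have hR : 0 ≤ R := (nsq_nonneg A).trans hA
    have key : ∀ i j, (A i j) ^ 2 ≤ R := by
      unfold nsq at hA
      simp only [Fin.forall_fin_two]
      refine ⟨⟨?_, ?_⟩, ?_, ?_⟩ <;>
        nlinarith [sq_nonneg (A 0 0), sq_nonneg (A 0 1), sq_nonneg (A 1 0), sq_nonneg (A 1 1)]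
    refine (Metric.mem_closedBall (α := Fin 2 → Fin 2 → ℝ)).2 ((dist_pi_le_iff (by linarith)).2 fun i =>
      (dist_pi_le_iff (by linarith)).2 fun j => ?_)
    rw [Real.dist_eq]
    simp only [Pi.zero_apply, sub_zero]
    exact abs_le_of_sq_le_sq (by nlinarith [key i j]) (by linarith)
  exact (isCompact_closedBall (α := Fin 2 → Fin 2 → ℝ) 0 (R + 1)).of_isClosed_subset hclosed hsub

/-- Each point has a neighbourhood in which quotients are too small to be nontrivial in the group,
so it contains at most one group element; compactness does the rest. -/
theorem finite_lift_nsq_le {Γ : Subgroup PSL2R} (hΓ : DiscreteTopology Γ) (R : ℝ) :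
    {m : SL(2, ℝ) | m ∈ lift Γ ∧ nsq m.1 ≤ R}.Finite := by
  obtain ⟨ε, hε, h⟩ := exists_size_lt_eq_one hΓ
  have key : ({m : SL(2, ℝ) | nsq m.1 ≤ R} ∩ lift Γ).Finite := by
    refine (isCompact_nsq_le R).induction_on (p := fun s => (s ∩ lift Γ).Finite) (by simp)
      (fun s t hst ht => ht.subset (Set.inter_subset_inter_left _ hst))
      (fun s t hs ht => by rw [Set.union_inter_distrib_right]; exact hs.union ht) ?_
    intro x _
    have hc : Continuous fun p : SL(2, ℝ) × SL(2, ℝ) => size (p.1⁻¹ * p.2) :=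
      continuous_size.comp (continuous_fst.inv.mul continuous_snd)
    have hopen : IsOpen {p : SL(2, ℝ) × SL(2, ℝ) | size (p.1⁻¹ * p.2) < ε} :=
      isOpen_lt hc continuous_const
    have hmem : (x, x) ∈ {p : SL(2, ℝ) × SL(2, ℝ) | size (p.1⁻¹ * p.2) < ε} := by
      simp [size_eq_zero_iff.2, hε]
    obtain ⟨U, hU, V, hV, hUV⟩ := mem_nhds_prod_iff.1 (hopen.mem_nhds hmem)
    refine ⟨U ∩ V, mem_nhdsWithin_of_mem_nhds (Filter.inter_mem hU hV), ?_⟩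
    refine Set.Subsingleton.finite fun a ha b hb => ?_
    have h1 : size (a⁻¹ * b) < ε := @hUV (a, b) ⟨ha.1.1, hb.1.2⟩
    exact inv_mul_eq_one.1 (h _ ((lift Γ).mul_mem ((lift Γ).inv_mem ha.2) hb.2) h1)
  exact key.subset fun m hm => ⟨hm.2, hm.1⟩

theorem countable_of_discrete {Γ : Subgroup PSL2R} (hΓ : DiscreteTopology Γ) : Countable Γ := by
  have h1 : ((lift Γ : Set SL(2, ℝ))).Countable := by
    have : (lift Γ : Set SL(2, ℝ)) = ⋃ n : ℕ, {m : SL(2, ℝ) | m ∈ lift Γ ∧ nsq m.1 ≤ n} := by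
      ext m
      simp only [Set.mem_iUnion, Set.mem_ofPred_eq]
      exact ⟨fun hm => (exists_nat_ge (nsq m.1)).imp fun n hn => ⟨hm, hn⟩, fun ⟨_, hm, _⟩ => hm⟩
    rw [this]
    exact Set.countable_iUnion fun n => (finite_lift_nsq_le hΓ n).countable
  have h2 : (Γ : Set PSL2R) ⊆ proj '' (lift Γ) := by
    intro c hc
    obtain ⟨m, rfl⟩ := QuotientGroup.mk_surjective c
    exact ⟨m, hc, rfl⟩
  exact ((h1.image _).mono h2).to_subtype

/-! ### Shortest elements of the conjugates of the group. -/

/-- `n` is a nontrivial element of `g⁻¹ Γ g` closest to the identity. -/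
structure IsShortest (Γ : Subgroup PSL2R) (g n : SL(2, ℝ)) : Prop where
  ne_one : n ≠ 1
  mem : g * n * g⁻¹ ∈ lift Γ
  le : ∀ m, m ≠ 1 → g * m * g⁻¹ ∈ lift Γ → size n ≤ size m

theorem finite_conj_size_le {Γ : Subgroup PSL2R} (hΓ : DiscreteTopology Γ) (g : SL(2, ℝ)) (R : ℝ) :
    {m : SL(2, ℝ) | g * m * g⁻¹ ∈ lift Γ ∧ size m ≤ R}.Finite := by
  have h := finite_lift_nsq_le hΓ (nsq g.1 * (2 * R + 4) * nsq g.1)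
  refine Set.Finite.of_finite_image (f := fun m => g * m * g⁻¹) (h.subset ?_) ?_
  · rintro _ ⟨m, ⟨h1, h2⟩, rfl⟩
    refine ⟨h1, (nsq_mul_val_le _ _).trans ?_⟩
    rw [nsq_inv]
    refine mul_le_mul_of_nonneg_right ((nsq_mul_val_le _ _).trans ?_) (nsq_nonneg _)
    exact mul_le_mul_of_nonneg_left ((nsq_le_of_size m).trans (by linarith)) (nsq_nonneg _)
  · intro a _ b _ hab
    simpa using hab

theorem exists_isShortest {Γ : Subgroup PSL2R} (hΓ : DiscreteTopology Γ) (g : SL(2, ℝ)) :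
    ∃ n, IsShortest Γ g n := by
  have hfin : {m : SL(2, ℝ) | m ≠ 1 ∧ g * m * g⁻¹ ∈ lift Γ ∧ size m ≤ 8}.Finite :=
    (finite_conj_size_le hΓ g 8).subset fun m hm => hm.2
  -- `-1` belongs to every conjugate, so only candidates up to its size matter.
  have hne : (-1 : SL(2, ℝ)) ∈ {m : SL(2, ℝ) | m ≠ 1 ∧ g * m * g⁻¹ ∈ lift Γ ∧ size m ≤ 8} := by
    refine ⟨fun h => ?_, ?_, size_neg_one.le⟩
    · have := size_neg_one
      rw [h, size_eq_zero_iff.2 rfl] at this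
      norm_num at this
    · simpa using neg_one_mem_lift Γ
  obtain ⟨n, hn, hmin⟩ := hfin.exists_minimalFor size _ ⟨_, hne⟩
  refine ⟨n, hn.1, hn.2.1, fun m h1 h2 => ?_⟩
  rcases le_total (size m) 8 with h3 | h3
  · by_contra hlt
    exact hlt (hmin ⟨h1, h2, h3⟩ (not_le.1 hlt).le)
  · exact hn.2.2.trans h3

/-! ### Commuting elements -/

theorem eq_one_or_eq_neg_one {n : SL(2, ℝ)} (hb : n.1 0 1 = 0) (hc : n.1 1 0 = 0)
    (h : n.1 0 0 = n.1 1 1) : n = 1 ∨ n = -1 := by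
  have hd := det_eq n
  rw [hb, ← h] at hd
  have h4 : n.1 0 0 = 1 ∨ n.1 0 0 = -1 := mul_self_eq_one_iff.1 (by linarith)
  rcases h4 with h4 | h4
  · exact Or.inl (sl_ext (by simp [h4]) (by simp [hb]) (by simp [hc]) (by simp [← h, h4]))
  · exact Or.inr (sl_ext (by simp [h4]) (by simp [hb]) (by simp [hc]) (by simp [← h, h4]))

/-- Commuting means that the trace-free parts are parallel; any nonzero coordinate of that of `n`
gives the ratio `β`. -/
theorem exists_linear_of_commute {n m : SL(2, ℝ)} (h1 : n ≠ 1) (h2 : n ≠ -1) (h : m * n = n * m) :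
    ∃ α β : ℝ, m.1 = α • (1 : Matrix (Fin 2) (Fin 2) ℝ) + β • n.1 := by
  have hv := congrArg Subtype.val h
  rw [mul_val, mul_val] at hv
  have e00 := congrFun (congrFun hv 0) 0
  have e01 := congrFun (congrFun hv 0) 1
  have e10 := congrFun (congrFun hv 1) 0
  simp only [Matrix.of_apply, Matrix.cons_val', Matrix.cons_val_zero, Matrix.cons_val_one,
    Matrix.cons_val_fin_one] at e00 e01 e10
  have build : ∀ β : ℝ, m.1 0 1 = β * n.1 0 1 → m.1 1 0 = β * n.1 1 0 →
      m.1 0 0 - m.1 1 1 = β * (n.1 0 0 - n.1 1 1) →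
      ∃ α β : ℝ, m.1 = α • (1 : Matrix (Fin 2) (Fin 2) ℝ) + β • n.1 := by
    intro β k1 k2 k3
    refine ⟨m.1 0 0 - β * n.1 0 0, β, ?_⟩
    ext i j
    fin_cases i <;> fin_cases j <;> simp [k1, k2]
    linarith
  by_cases hb : n.1 0 1 = 0
  · by_cases hc : n.1 1 0 = 0
    · have hne : n.1 0 0 - n.1 1 1 ≠ 0 := by
        intro h0
        exact (eq_one_or_eq_neg_one hb hc (sub_eq_zero.1 h0)).elim h1 h2
      refine build ((m.1 0 0 - m.1 1 1) / (n.1 0 0 - n.1 1 1)) ?_ ?_ (by field_simp)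
      · rw [hb] at e01 ⊢
        rw [mul_zero]
        have : m.1 0 1 * (n.1 0 0 - n.1 1 1) = 0 := by linarith
        exact (mul_eq_zero.1 this).resolve_right hne
      · rw [hc] at e10 ⊢
        rw [mul_zero]
        have : m.1 1 0 * (n.1 0 0 - n.1 1 1) = 0 := by linarith
        exact (mul_eq_zero.1 this).resolve_right hne
    · refine build (m.1 1 0 / n.1 1 0) ?_ (by field_simp) ?_
      · field_simp; linarith
      · field_simp; linarith
  · refine build (m.1 0 1 / n.1 0 1) (by field_simp) ?_ ?_
    · field_simp; linarith
    · field_simp; linarith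

/-- The squared Frobenius norm of the trace-free part. -/
def tfree (n : SL(2, ℝ)) : ℝ := (n.1 0 0 - n.1 1 1) ^ 2 / 2 + n.1 0 1 ^ 2 + n.1 1 0 ^ 2

theorem size_eq_tfree (n : SL(2, ℝ)) :
    size n = 2 * ((n.1 0 0 + n.1 1 1) / 2 - 1) ^ 2 + tfree n := by
  rw [size_eq, tfree]; ring

theorem tfree_pos {n : SL(2, ℝ)} (h1 : n ≠ 1) (h2 : n ≠ -1) : 0 < tfree n := by
  have h0 : 0 ≤ tfree n := by unfold tfree; positivity
  refine lt_of_le_of_ne h0 fun h => ?_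
  unfold tfree at h
  have hb : n.1 0 1 = 0 := by
    nlinarith [sq_nonneg (n.1 0 0 - n.1 1 1), sq_nonneg (n.1 0 1), sq_nonneg (n.1 1 0)]
  have hc : n.1 1 0 = 0 := by
    nlinarith [sq_nonneg (n.1 0 0 - n.1 1 1), sq_nonneg (n.1 0 1), sq_nonneg (n.1 1 0)]
  have h3 : n.1 0 0 - n.1 1 1 = 0 := by
    nlinarith [sq_nonneg (n.1 0 0 - n.1 1 1), sq_nonneg (n.1 0 1), sq_nonneg (n.1 1 0)]
  exact (eq_one_or_eq_neg_one hb hc (sub_eq_zero.1 h3)).elim h1 h2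

/-- Here `a`, `b` are half traces and `l` is the ratio of the trace-free parts. If `l² < 1`, then
`b` is at least as close to 1 as `a`, and `h` fails; hence `l² ≥ 1`, so `a` is at least as close to
1 as `b`, and the inequality holds for every `q'`. Thus the comparison is independent of `q`, the
only quantity changed by conjugation. -/
theorem size_le_transfer {a b l q q' : ℝ} (ha : 0 < a) (hb : 0 < b) (hq : 0 < q) (hq' : 0 ≤ q')
    (hab : 1 - b ^ 2 = l ^ 2 * (1 - a ^ 2))
    (h : 2 * (a - 1) ^ 2 + q ≤ 2 * (b - 1) ^ 2 + l ^ 2 * q) :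
    2 * (a - 1) ^ 2 + q' ≤ 2 * (b - 1) ^ 2 + l ^ 2 * q' := by
  have hl : 1 ≤ l ^ 2 := by
    by_contra! hl
    have hba : (b - 1) ^ 2 ≤ (a - 1) ^ 2 := by
      rcases le_total 1 a with h1 | h1
      · have hb1 : 1 ≤ b := by nlinarith [sq_nonneg l]
        have : b ≤ a := by nlinarith [sq_nonneg l]
        nlinarith
      · have h3 : 0 ≤ 1 - a ^ 2 := by nlinarith
        have h4 : l ^ 2 * (1 - a ^ 2) ≤ 1 * (1 - a ^ 2) := mul_le_mul_of_nonneg_right hl.le h3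
        have hb1 : b ≤ 1 := by nlinarith [sq_nonneg l]
        have : a ≤ b := by nlinarith
        nlinarith
    nlinarith
  have hba : (a - 1) ^ 2 ≤ (b - 1) ^ 2 := by
    rcases le_total 1 a with h1 | h1
    · have : a ≤ b := by nlinarith [sq_nonneg l]
      nlinarith
    · have h3 : 0 ≤ 1 - a ^ 2 := by nlinarith
      have h4 : 1 * (1 - a ^ 2) ≤ l ^ 2 * (1 - a ^ 2) := mul_le_mul_of_nonneg_right hl h3
      have : b ≤ a := by nlinarith
      nlinarith
  nlinarith

theorem tfree_linear {n m : SL(2, ℝ)} {α β : ℝ}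
    (h : m.1 = α • (1 : Matrix (Fin 2) (Fin 2) ℝ) + β • n.1) : tfree m = β ^ 2 * tfree n := by
  simp [tfree, h]; ring

theorem det_linear {n m : SL(2, ℝ)} {α β : ℝ}
    (h : m.1 = α • (1 : Matrix (Fin 2) (Fin 2) ℝ) + β • n.1) :
    1 - ((m.1 0 0 + m.1 1 1) / 2) ^ 2 = β ^ 2 * (1 - ((n.1 0 0 + n.1 1 1) / 2) ^ 2) := by
  have hm := det_eq m
  have hn := det_eq n
  simp only [h, Matrix.add_apply, Matrix.smul_apply, smul_eq_mul, Matrix.one_apply_eq,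
    Matrix.one_apply_ne (zero_ne_one : (0 : Fin 2) ≠ 1),
    Matrix.one_apply_ne (one_ne_zero : (1 : Fin 2) ≠ 0)] at hm ⊢
  linear_combination β ^ 2 * hn - hm

theorem trace_conj (u n : SL(2, ℝ)) :
    (u * n * u⁻¹).1 0 0 + (u * n * u⁻¹).1 1 1 = n.1 0 0 + n.1 1 1 := by
  have hd := det_eq u
  simp only [mul_val, inv_val, Matrix.of_apply, Matrix.cons_val', Matrix.cons_val_zero,
    Matrix.cons_val_one, Matrix.cons_val_fin_one]
  linear_combination (n.1 0 0 + n.1 1 1) * hd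

theorem half_trace_pos {n : SL(2, ℝ)} (h : size n ≤ 1 / 100) : 0 < (n.1 0 0 + n.1 1 1) / 2 := by
  have h0 : 0 ≤ tfree n := by unfold tfree; positivity
  rw [size_eq_tfree] at h
  nlinarith

theorem conj_linear {n m : SL(2, ℝ)} {α β : ℝ}
    (h : m.1 = α • (1 : Matrix (Fin 2) (Fin 2) ℝ) + β • n.1) (u : SL(2, ℝ)) :
    (u * m * u⁻¹).1 = α • (1 : Matrix (Fin 2) (Fin 2) ℝ) + β • (u * n * u⁻¹).1 := by
  have hu : u.1 * (u⁻¹).1 = 1 := by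
    rw [← Matrix.SpecialLinearGroup.coe_mul]; simp
  simp only [Matrix.SpecialLinearGroup.coe_mul, h]
  rw [mul_add, add_mul, Matrix.mul_smul, mul_one, Matrix.smul_mul, hu, Matrix.mul_smul,
    Matrix.smul_mul]

/-- A short shortest element stays shortest as long as it stays short. -/
theorem IsShortest.conj {Γ : Subgroup PSL2R} (hΓ : DiscreteTopology Γ) {g n u : SL(2, ℝ)}
    (hn : IsShortest Γ g n) (h1 : size n ≤ 1 / 100) (h2 : size (u⁻¹ * n * u) ≤ 1 / 100) :
    IsShortest Γ (g * u) (u⁻¹ * n * u) := by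
  have hmem : g * u * (u⁻¹ * n * u) * (g * u)⁻¹ ∈ lift Γ := by
    have : g * u * (u⁻¹ * n * u) * (g * u)⁻¹ = g * n * g⁻¹ := by group
    rw [this]; exact hn.mem
  have hne : u⁻¹ * n * u ≠ 1 := by
    intro h
    apply hn.ne_one
    have : n = u * (u⁻¹ * n * u) * u⁻¹ := by group
    rw [this, h]; simp
  have hneg : ∀ x : SL(2, ℝ), size x ≤ 1 / 100 → x ≠ -1 := by
    rintro x hx rfl
    rw [size_neg_one] at hx; norm_num at hx
  obtain ⟨m, hm⟩ := exists_isShortest hΓ (g * u)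
  have hmn := hm.le _ hne hmem
  suffices size (u⁻¹ * n * u) ≤ size m from
    ⟨hne, hmem, fun k k1 k2 => this.trans (hm.le k k1 k2)⟩
  have hm100 := hmn.trans h2
  -- A nontrivial commutator would be a group element shorter than the shortest one.
  have hcomm : m * (u⁻¹ * n * u) = u⁻¹ * n * u * m := by
    by_contra hc
    have hk : m * (u⁻¹ * n * u) * m⁻¹ * (u⁻¹ * n * u)⁻¹ ≠ 1 := by
      intro h
      apply hc
      rw [mul_inv_eq_one, mul_inv_eq_iff_eq_mul] at h
      exact h
    refine absurd (hm.le _ hk ?_) (not_le.2 (size_commutator_lt hm100 h2 hm.ne_one))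
    have e : ∀ k y x : SL(2, ℝ), k * (x * y * x⁻¹ * y⁻¹) * k⁻¹ =
        (k * x * k⁻¹) * (k * y * k⁻¹) * (k * x * k⁻¹)⁻¹ * (k * y * k⁻¹)⁻¹ := by
      intro k y x; group
    rw [e]
    exact (lift Γ).mul_mem ((lift Γ).mul_mem ((lift Γ).mul_mem hm.mem hmem)
      ((lift Γ).inv_mem hm.mem)) ((lift Γ).inv_mem hmem)
  obtain ⟨α, β, hlin⟩ := exists_linear_of_commute hne (hneg _ h2) hcomm
  have hlin' := conj_linear hlin u
  have en : u * (u⁻¹ * n * u) * u⁻¹ = n := by group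
  -- Minimality of `n` at `g` compares the two commuting elements before conjugation by `u`;
  -- `size_le_transfer` carries this comparison over to `g u`.
  have hm' : size n ≤ size (u * m * u⁻¹) := by
    refine hn.le _ ?_ ?_
    · intro h
      apply hm.ne_one
      have : m = u⁻¹ * (u * m * u⁻¹) * u := by group
      rw [this, h]; simp
    · have : g * (u * m * u⁻¹) * g⁻¹ = g * u * m * (g * u)⁻¹ := by group
      rw [this]; exact hm.mem
  rw [size_eq_tfree, size_eq_tfree (u * m * u⁻¹), tfree_linear hlin', trace_conj, en] at hm'
  have htr := trace_conj u (u⁻¹ * n * u)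
  rw [en] at htr
  have hdet := det_linear hlin
  rw [← htr] at hdet
  rw [size_eq_tfree, size_eq_tfree m, tfree_linear hlin, ← htr]
  exact size_le_transfer (half_trace_pos h1) (half_trace_pos hm100)
    (tfree_pos hn.ne_one (hneg _ h1)) (tfree_pos hne (hneg _ h2)).le hdet hm'

/-! ### The quotient -/

theorem pt_eq_iff {Γ : Subgroup PSL2R} {a b : SL(2, ℝ)} :
    pt Γ (proj a) = pt Γ (proj b) ↔ ∃ c ∈ lift Γ, a = c * b := by
  constructor
  · intro h
    obtain ⟨⟨c, hc⟩, he⟩ := Quotient.exact h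
    obtain ⟨m, rfl⟩ := QuotientGroup.mk_surjective c
    have he' : proj (m * b) = proj a := he
    rcases proj_eq_iff.1 he' with h1 | h1
    · exact ⟨m, hc, h1.symm⟩
    · refine ⟨-m, ?_, ?_⟩
      · rw [mem_lift, proj_neg]; exact hc
      · rw [neg_mul, h1, neg_neg]
  · rintro ⟨c, hc, rfl⟩
    exact Quotient.sound ⟨⟨proj c, hc⟩, rfl⟩

theorem dX_le {Γ : Subgroup PSL2R} (g₁ g₂ : PSL2R) : dX Γ (pt Γ g₁) (pt Γ g₂) ≤ dG g₁ g₂ := by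
  have hmem : dG g₁ g₂ ∈ {d : ℝ | ∃ k₁ k₂ : PSL2R, pt Γ k₁ = pt Γ g₁ ∧ pt Γ k₂ = pt Γ g₂ ∧
      d = dG k₁ k₂} := ⟨g₁, g₂, rfl, rfl, rfl⟩
  refine csInf_le ⟨0, ?_⟩ hmem
  rintro _ ⟨k₁, k₂, -, -, rfl⟩
  exact dG_nonneg _ _

theorem exists_joins_of_dX_lt {Γ : Subgroup PSL2R} {g₁ g₂ : PSL2R} {D : ℝ}
    (h : dX Γ (pt Γ g₁) (pt Γ g₂) < D) :
    ∃ k₁ k₂ : PSL2R, pt Γ k₁ = pt Γ g₁ ∧ pt Γ k₂ = pt Γ g₂ ∧ Joins k₁ k₂ D := by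
  have hmem : dG g₁ g₂ ∈ {d : ℝ | ∃ k₁ k₂ : PSL2R, pt Γ k₁ = pt Γ g₁ ∧ pt Γ k₂ = pt Γ g₂ ∧
      d = dG k₁ k₂} := ⟨g₁, g₂, rfl, rfl, rfl⟩
  obtain ⟨_, ⟨k₁, k₂, h1, h2, rfl⟩, hlt⟩ := exists_lt_of_csInf_lt ⟨_, hmem⟩ h
  exact ⟨k₁, k₂, h1, h2, exists_joins_lt hlt⟩

/-! ### The thick part -/

/-- No nontrivial element of `g⁻¹ Γ g` is `ε`-close to the identity. -/
def IsThick (Γ : Subgroup PSL2R) (ε : ℝ) (g : SL(2, ℝ)) : Prop :=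
  ∀ m, m ≠ 1 → g * m * g⁻¹ ∈ lift Γ → ε ≤ size m

/-- From `b₁ b₂⁻¹ - 1 = (b₁ - b₂) b₂⁻¹`: the factors are at most `4ε/25` and 6. This makes a ball
around a thick point inject into the quotient. -/
theorem size_mul_inv_lt {ε : ℝ} {b₁ b₂ : SL(2, ℝ)} (h1 : size b₁ < min 1 (ε / 25))
    (h2 : size b₂ < min 1 (ε / 25)) : size (b₁ * b₂⁻¹) < ε := by
  have e : (b₁ * b₂⁻¹).1 - 1 = ((b₁.1 - 1) - (b₂.1 - 1)) * (b₂⁻¹).1 := by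
    have : b₂.1 * (b₂⁻¹).1 = 1 := by rw [← Matrix.SpecialLinearGroup.coe_mul]; simp
    rw [sub_sub_sub_cancel_right, sub_mul, this, Matrix.SpecialLinearGroup.coe_mul]
  have h3 := nsq_sub_le (b₁.1 - 1) (b₂.1 - 1)
  have h4 := nsq_le_of_size b₂
  have h5 := nsq_mul_le ((b₁.1 - 1) - (b₂.1 - 1)) (b₂⁻¹).1
  rw [nsq_inv, ← e] at h5
  rw [lt_min_iff] at h1 h2
  change nsq _ < ε
  change _ ≤ 2 * size b₁ + 2 * size b₂ at h3
  have h6 : 0 ≤ nsq (b₁.1 - 1 - (b₂.1 - 1)) := nsq_nonneg _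
  have h7 : nsq (b₁.1 - 1 - (b₂.1 - 1)) * nsq b₂.1 ≤ nsq (b₁.1 - 1 - (b₂.1 - 1)) * 6 :=
    mul_le_mul_of_nonneg_left (by linarith) h6
  have := size_nonneg b₁
  linarith

open MeasureTheory Pointwise in
/-- Modulo a lattice, the thick part is bounded. -/
theorem exists_bound_of_isThick [MeasurableSpace PSL2R] [BorelSpace PSL2R]
    {μ : Measure PSL2R} [μ.IsHaarMeasure] {Γ : Subgroup PSL2R}
    (hΓ : IsLattice μ Γ) {ε : ℝ} (hε : 0 < ε) :
    ∃ R : ℝ, 0 ≤ R ∧ ∀ g, IsThick Γ ε g → ∃ c ∈ lift Γ, ∃ f : SL(2, ℝ), g = c * f ∧ nsq f.1 ≤ R := by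
  obtain ⟨F, hF, hFfin⟩ := hΓ.finite_covolume
  have hcount : Countable Γ := countable_of_discrete hΓ.discrete
  have hval : Continuous fun m : SL(2, ℝ) => m.1 := continuous_subtype_val
  set U : ℕ → Set PSL2R := fun n => proj '' {m | nsq m.1 < n} with hU
  have hUo : ∀ n, IsOpen (U n) := fun n => QuotientGroup.isOpenMap_coe _
    (isOpen_lt (continuous_nsq.comp hval) continuous_const)
  set B : Set PSL2R := proj '' {b | size b < min 1 (ε / 25)} with hB
  have hBo : IsOpen B := QuotientGroup.isOpenMap_coe _ (isOpen_lt continuous_size continuous_const)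
  have hBpos : 0 < μ B := by
    refine hBo.measure_pos μ ⟨proj 1, 1, ?_, rfl⟩
    change size 1 < _
    rw [size_eq_zero_iff.2 rfl]; positivity
  have hlim : Filter.Tendsto (fun n => μ (F \ U n)) Filter.atTop (nhds 0) := by
    have h := tendsto_measure_iInter_atTop (μ := μ) (s := fun n => F \ U n)
      (fun n => hF.nullMeasurableSet.diff (hUo n).measurableSet.nullMeasurableSet) ?_
      ⟨0, ((measure_mono Set.sdiff_subset).trans_lt hFfin).ne⟩
    · have he : ⋂ n, F \ U n = ∅ := by
        rw [Set.eq_empty_iff_forall_notMem]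
        intro x hx
        obtain ⟨m, rfl⟩ := QuotientGroup.mk_surjective x
        obtain ⟨n, hn⟩ := exists_nat_gt (nsq m.1)
        exact (Set.mem_iInter.1 hx n).2 ⟨m, hn, rfl⟩
      rwa [he, measure_empty] at h
    · intro i j hij
      refine Set.sdiff_subset_sdiff_right (Set.image_mono fun m hm => ?_)
      exact lt_of_lt_of_le (show nsq m.1 < i from hm) (Nat.cast_le.2 hij)
  -- What remains of `F` outside a large ball is too small to hold a copy of `B`.
  obtain ⟨n, hn⟩ := (hlim.eventually (gt_mem_nhds hBpos)).exists
  refine ⟨n * 6, by positivity, fun g hg => ?_⟩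
  by_contra! hno
  set t : Set PSL2R := (fun x => (proj g)⁻¹ * x) ⁻¹' B with ht
  have htm : μ t = μ B := measure_preimage_mul μ _ _
  have hto : IsOpen t := hBo.preimage (continuous_const.mul continuous_id)
  have hmem : ∀ (c : Γ) (x : SL(2, ℝ)), proj x ∈ c • t →
      ∃ γ b : SL(2, ℝ), size b < min 1 (ε / 25) ∧ γ ∈ lift Γ ∧ proj γ = c ∧ x = γ * g * b := by
    rintro c x ⟨y, ⟨b, hb, hby⟩, hxy⟩
    obtain ⟨γ, hγ⟩ := QuotientGroup.mk_surjective (c : PSL2R)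
    have hy : y = proj (g * b) := by
      change _ = (proj g)⁻¹ * y at hby
      rw [eq_inv_mul_iff_mul_eq] at hby
      exact hby.symm
    have hx : proj x = proj (γ * g * b) := by
      rw [← hxy, mul_assoc, hy]
      change (c : PSL2R) * proj (g * b) = _
      rw [← hγ]; rfl
    have hγl : γ ∈ lift Γ := by
      rw [mem_lift, show proj γ = c from hγ]; exact c.2
    rcases proj_eq_iff.1 hx with h1 | h1
    · exact ⟨γ, b, hb, hγl, hγ, h1⟩
    · refine ⟨-γ, b, hb, ?_, ?_, ?_⟩
      · rw [mem_lift, proj_neg]; exact hγl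
      · rw [proj_neg]; exact hγ
      · rw [h1]; simp only [neg_mul]
  -- Thickness of `g` makes the translates of `t = gB` disjoint.
  have hdis : Pairwise (Function.onFun (AEDisjoint μ) fun c : Γ => c • t ∩ F) := by
    intro c₁ c₂ hne
    refine Disjoint.aedisjoint (Set.disjoint_left.2 fun x h1 h2 => hne ?_)
    obtain ⟨m, rfl⟩ := QuotientGroup.mk_surjective x
    obtain ⟨γ₁, b₁, s1, l1, p1, e1⟩ := hmem c₁ m h1.1
    obtain ⟨γ₂, b₂, s2, l2, p2, e2⟩ := hmem c₂ m h2.1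
    have hconj : g * (b₁ * b₂⁻¹) * g⁻¹ = γ₁⁻¹ * γ₂ := by
      have e : γ₁ * g * b₁ = γ₂ * g * b₂ := e1.symm.trans e2
      have e' : b₁ = (γ₁ * g)⁻¹ * (γ₂ * g * b₂) := by rw [← e]; group
      rw [e']; group
    have hb : b₁ * b₂⁻¹ = 1 := by
      by_contra hb
      refine absurd (hg _ hb ?_) (not_le.2 (size_mul_inv_lt s1 s2))
      rw [hconj]
      exact (lift Γ).mul_mem ((lift Γ).inv_mem l1) l2
    rw [hb, mul_one, mul_inv_cancel] at hconj
    have h12 : γ₁ = γ₂ := inv_mul_eq_one.1 hconj.symm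
    exact Subtype.ext (by rw [← p1, ← p2, h12])
  -- Under the assumption `hno`, no translate of `gB` meets `U n`, so all of its measure would fit
  -- into `F \ U n`.
  have hle : μ t ≤ μ (F \ U n) := by
    rw [hF.measure_eq_tsum t, ← measure_iUnion₀ hdis fun c =>
      (hto.measurableSet.nullMeasurableSet.smul c).inter hF.nullMeasurableSet]
    refine measure_mono (Set.iUnion_subset fun c x hx => ⟨hx.2, ?_⟩)
    rintro ⟨f, hf, rfl⟩
    obtain ⟨γ, b, hb, hγ, -, e⟩ := hmem c f hx.1
    have hlt := hno γ⁻¹ ((lift Γ).inv_mem hγ) (f * b⁻¹) (by rw [e]; group)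
    refine absurd ((nsq_mul_val_le f b⁻¹).trans ?_) (not_le.2 hlt)
    rw [nsq_inv]
    have h4 := nsq_le_of_size b
    have h5 := (lt_min_iff.1 hb).1
    exact mul_le_mul (le_of_lt hf) (by linarith) (nsq_nonneg _) (by positivity)
  rw [htm] at hle
  exact absurd hle (not_le.2 hn)

/-! ### Small elements are unipotent -/

theorem continuous_sl {γ : ℝ → SL(2, ℝ)} (h : ∀ i j, Continuous fun t => (γ t).1 i j) :
    Continuous γ :=
  continuous_induced_rng.2 (continuous_matrix h)

theorem continuous_aExpSL : Continuous aExpSL := by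
  refine continuous_sl fun i j => ?_
  fin_cases i <;> fin_cases j <;> simp [aExpSL_val] <;> fun_prop

theorem continuous_hSL : Continuous hSL := by
  refine continuous_sl fun i j => ?_
  fin_cases i <;> fin_cases j <;> simp [hSL_val] <;> fun_prop

/-- Intermediate value theorem along a path from the identity: a nonzero off-diagonal entry is
rescaled to absolute value one by the diagonal group, and for diagonal `n` such an entry is created
by `hSL`. -/
theorem exists_size_conj_eq {n : SL(2, ℝ)} (h1 : n ≠ 1) (hs : size n ≤ 1 / 100) :
    ∃ u : SL(2, ℝ), size (u⁻¹ * n * u) = 1 / 100 := by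
  have key : ∀ γ : ℝ → SL(2, ℝ), Continuous γ → γ 0 = 1 →
      (∃ t, 1 / 100 ≤ size ((γ t)⁻¹ * n * γ t)) → ∃ u : SL(2, ℝ), size (u⁻¹ * n * u) = 1 / 100 := by
    intro γ hγ h0 ht
    have hc : Continuous fun t => size ((γ t)⁻¹ * n * γ t) :=
      continuous_size.comp ((hγ.inv.mul continuous_const).mul hγ)
    obtain ⟨t, ht⟩ := mem_range_of_exists_le_of_exists_ge hc ⟨0, by simpa [h0] using hs⟩ ht
    exact ⟨γ t, ht⟩
  have hsz : ∀ m : SL(2, ℝ), m.1 0 1 ^ 2 = 1 ∨ m.1 1 0 ^ 2 = 1 → 1 / 100 ≤ size m := by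
    intro m hm
    rw [size_eq]
    rcases hm with h | h <;> rw [h] <;>
      nlinarith [sq_nonneg (m.1 0 0 - 1), sq_nonneg (m.1 1 1 - 1), sq_nonneg (m.1 0 1),
        sq_nonneg (m.1 1 0)]
  have ha0 : aExpSL 0 = 1 := by apply sl_ext <;> simp [aExpSL_val]
  have hh0 : hSL 0 = 1 := by apply sl_ext <;> simp [hSL_val]
  by_cases hb : n.1 0 1 = 0
  · by_cases hc : n.1 1 0 = 0
    · have hne : n.1 0 0 - n.1 1 1 ≠ 0 := by
        intro h0
        rcases eq_one_or_eq_neg_one hb hc (sub_eq_zero.1 h0) with rfl | rfl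
        · exact h1 rfl
        · rw [size_neg_one] at hs; norm_num at hs
      refine key hSL continuous_hSL hh0 ⟨1 / (n.1 0 0 - n.1 1 1), hsz _ (Or.inl ?_)⟩
      simp only [mul_val, inv_val, hSL_val, Matrix.of_apply, Matrix.cons_val', Matrix.cons_val_zero,
        Matrix.cons_val_one, Matrix.cons_val_fin_one, hb, hc]
      field_simp
      ring
    · refine key aExpSL continuous_aExpSL ha0 ⟨-Real.log |n.1 1 0|, hsz _ (Or.inr ?_)⟩
      simp only [mul_val, inv_val, aExpSL_val, Matrix.of_apply, Matrix.cons_val',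
        Matrix.cons_val_zero, Matrix.cons_val_one, Matrix.cons_val_fin_one]
      have e : Real.exp (-Real.log |n.1 1 0| / 2) * Real.exp (-Real.log |n.1 1 0| / 2) *
          |n.1 1 0| = 1 := by
        nth_rw 3 [← Real.exp_log (abs_pos.2 hc)]
        rw [← Real.exp_add, ← Real.exp_add]; ring_nf; simp
      have e2 := sq_abs (n.1 1 0)
      have e3 : (Real.exp (-Real.log |n.1 1 0| / 2) * Real.exp (-Real.log |n.1 1 0| / 2) *
          n.1 1 0) ^ 2 = 1 := by rw [mul_pow, ← e2, ← mul_pow, e]; norm_num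
      exact Eq.trans (by ring) e3
  · refine key aExpSL continuous_aExpSL ha0 ⟨Real.log |n.1 0 1|, hsz _ (Or.inl ?_)⟩
    simp only [mul_val, inv_val, aExpSL_val, Matrix.of_apply, Matrix.cons_val',
      Matrix.cons_val_zero, Matrix.cons_val_one, Matrix.cons_val_fin_one]
    have e : Real.exp (-(Real.log |n.1 0 1| / 2)) * Real.exp (-(Real.log |n.1 0 1| / 2)) *
        |n.1 0 1| = 1 := by
      nth_rw 3 [← Real.exp_log (abs_pos.2 hb)]
      rw [← Real.exp_add, ← Real.exp_add]; ring_nf; simp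
    have e2 := sq_abs (n.1 0 1)
    have e3 : (Real.exp (-(Real.log |n.1 0 1| / 2)) * Real.exp (-(Real.log |n.1 0 1| / 2)) *
        n.1 0 1) ^ 2 = 1 := by rw [mul_pow, ← e2, ← mul_pow, e]; norm_num
    exact Eq.trans (by ring) e3

theorem IsShortest.isThick {Γ : Subgroup PSL2R} {g n : SL(2, ℝ)} {ε : ℝ} (h : IsShortest Γ g n)
    (hε : ε ≤ size n) : IsThick Γ ε g := fun m h1 h2 => hε.trans (h.le m h1 h2)

/-- Finitely many traces cannot accumulate at 2. The factor two matches `(trace - 2)² ≤ 2 size`. -/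
theorem exists_gap {S : Set SL(2, ℝ)} (hS : S.Finite) : ∃ ε > 0, ∀ m ∈ S,
    m.1 0 0 + m.1 1 1 ≠ 2 → 2 * ε ≤ (m.1 0 0 + m.1 1 1 - 2) ^ 2 := by
  induction S, hS using Set.Finite.induction_on with
  | empty => exact ⟨1, one_pos, by simp⟩
  | @insert a s _ _ ih =>
    obtain ⟨ε, hε, h⟩ := ih
    by_cases ha : a.1 0 0 + a.1 1 1 = 2
    · refine ⟨ε, hε, fun m hm hm2 => ?_⟩
      rcases hm with rfl | hm
      · exact absurd ha hm2
      · exact h m hm hm2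
    · have hpos : 0 < (a.1 0 0 + a.1 1 1 - 2) ^ 2 := by
        have : a.1 0 0 + a.1 1 1 - 2 ≠ 0 := sub_ne_zero.2 ha
        positivity
      refine ⟨min ε ((a.1 0 0 + a.1 1 1 - 2) ^ 2 / 2), by positivity, fun m hm hm2 => ?_⟩
      rcases hm with rfl | hm
      · have := min_le_right ε ((m.1 0 0 + m.1 1 1 - 2) ^ 2 / 2); linarith
      · have := min_le_left ε ((a.1 0 0 + a.1 1 1 - 2) ^ 2 / 2)
        linarith [h m hm hm2]

open MeasureTheory in
/-- In a lattice, shortest elements that are sufficiently short are unipotent. -/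
theorem exists_trace_eq_two [MeasurableSpace PSL2R] [BorelSpace PSL2R]
    {μ : Measure PSL2R} [μ.IsHaarMeasure] {Γ : Subgroup PSL2R} (hΓ : IsLattice μ Γ) :
    ∃ ε > 0, ε ≤ 1 / 100 ∧ ∀ g n, IsShortest Γ g n → size n < ε → n.1 0 0 + n.1 1 1 = 2 := by
  obtain ⟨R, hR0, hR⟩ := exists_bound_of_isThick hΓ (ε := 1 / 100) (by norm_num)
  obtain ⟨ε, hε, hgap⟩ := exists_gap (finite_lift_nsq_le hΓ.discrete (R * (2 * (1 / 100) + 4) * R))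
  refine ⟨min ε (1 / 100), by positivity, min_le_right _ _, fun g n hn hs => ?_⟩
  have hs1 := hs.trans_le (min_le_left _ _)
  have hs2 := (hs.trans_le (min_le_right _ _)).le
  -- Once `n` has grown to size `1/100` it is still shortest, so the new point is thick. A conjugate
  -- of `n` then lies in the fixed finite set, and its trace obeys the gap.
  obtain ⟨u, hu⟩ := exists_size_conj_eq hn.ne_one hs2
  have hsh := hn.conj hΓ.discrete hs2 hu.le
  obtain ⟨c, hc, f, hgf, hf⟩ := hR _ (hsh.isThick hu.ge)
  by_contra htr
  have e : f * (u⁻¹ * n * u) * f⁻¹ = c⁻¹ * (g * n * g⁻¹) * c := by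
    have hfe : f = c⁻¹ * (g * u) := by rw [hgf]; group
    rw [hfe]; group
  have htr' : (f * (u⁻¹ * n * u) * f⁻¹).1 0 0 + (f * (u⁻¹ * n * u) * f⁻¹).1 1 1 =
      n.1 0 0 + n.1 1 1 := by
    rw [trace_conj]
    have := trace_conj u⁻¹ n
    rwa [inv_inv] at this
  have hmem : f * (u⁻¹ * n * u) * f⁻¹ ∈ lift Γ := by
    rw [e]
    exact (lift Γ).mul_mem ((lift Γ).mul_mem ((lift Γ).inv_mem hc) hn.mem) hc
  have hbd : nsq (f * (u⁻¹ * n * u) * f⁻¹).1 ≤ R * (2 * (1 / 100) + 4) * R := by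
    refine (nsq_mul_val_le _ _).trans ?_
    rw [nsq_inv]
    refine mul_le_mul ((nsq_mul_val_le _ _).trans ?_) hf (nsq_nonneg _) (by positivity)
    refine mul_le_mul hf ?_ (nsq_nonneg _) hR0
    rw [← hu]; exact nsq_le_of_size _
  have h2 := hgap _ ⟨hmem, hbd⟩ (by rw [htr']; exact htr)
  rw [htr'] at h2
  rw [size_eq] at hs1
  nlinarith [sq_nonneg (n.1 0 0 - 1 - (n.1 1 1 - 1)), sq_nonneg (n.1 0 1), sq_nonneg (n.1 1 0)]

/-! ### Cusps -/

theorem size_inv (n : SL(2, ℝ)) : size n⁻¹ = size n := by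
  rw [size_eq, size_eq, inv_val]
  simp only [Matrix.of_apply, Matrix.cons_val', Matrix.cons_val_zero, Matrix.cons_val_one,
    Matrix.cons_val_fin_one]
  ring

theorem IsShortest.inv {Γ : Subgroup PSL2R} {g n : SL(2, ℝ)} (h : IsShortest Γ g n) :
    IsShortest Γ g n⁻¹ where
  ne_one := inv_ne_one.2 h.ne_one
  mem := by
    have : g * n⁻¹ * g⁻¹ = (g * n * g⁻¹)⁻¹ := by group
    rw [this]; exact (lift Γ).inv_mem h.mem
  le m h1 h2 := by rw [size_inv]; exact h.le m h1 h2

theorem size_le_nsq (n : SL(2, ℝ)) : size n ≤ 2 * nsq n.1 + 4 := by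
  have := nsq_sub_le n.1 1
  rw [nsq_one] at this
  unfold size
  linarith

theorem IsShortest.exists_unip {Γ : Subgroup PSL2R} {g n : SL(2, ℝ)} (h : IsShortest Γ g n)
    (htr : n.1 0 0 + n.1 1 1 = 2) :
    ∃ x y : ℝ, IsShortest Γ g (unip x y) ∧ size (unip x y) = size n := by
  obtain ⟨x, y, e | e⟩ := exists_unip_of_trace htr
  · exact ⟨x, y, e ▸ h, by rw [e]⟩
  · exact ⟨x, y, e ▸ h.inv, by rw [← e, size_inv]⟩

theorem compactSpace_X {Γ : Subgroup PSL2R} {R : ℝ}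
    (h : ∀ g : SL(2, ℝ), ∃ c ∈ lift Γ, ∃ f : SL(2, ℝ), g = c * f ∧ nsq f.1 ≤ R) :
    CompactSpace (X Γ) := by
  have hc : Continuous fun m : SL(2, ℝ) => pt Γ (proj m) :=
    continuous_quotient_mk'.comp QuotientGroup.continuous_mk
  refine ⟨?_⟩
  convert (isCompact_nsq_le R).image hc
  refine (Set.eq_univ_of_forall fun q => ?_).symm
  obtain ⟨x, rfl⟩ := Quotient.exists_rep q
  obtain ⟨g, rfl⟩ := QuotientGroup.mk_surjective x
  obtain ⟨c, hc, f, e, hf⟩ := h g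
  exact ⟨f, hf, (pt_eq_iff.2 ⟨c, hc, e⟩).symm⟩

theorem joins_of_nsq_bounds {f g : SL(2, ℝ)} {R : ℝ} (hf : nsq f.1 ≤ R) :
    Joins (proj f) (proj g) (4 + R * nsq g.1 + (R * nsq g.1) ^ 2) := by
  have h1 : nsq (f⁻¹ * g).1 ≤ R * nsq g.1 := by
    refine (nsq_mul_val_le _ _).trans ?_
    rw [nsq_inv]
    exact mul_le_mul_of_nonneg_right hf (nsq_nonneg _)
  have h2 := (joins_of_nsq_le h1).mul_left f
  have e1 : proj f * proj 1 = proj f := mul_one _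
  have e2 : proj f * proj (f⁻¹ * g) = proj g := by
    change proj (f * (f⁻¹ * g)) = _; rw [mul_inv_cancel_left]
  rwa [e1, e2] at h2

/-- A rotation followed by a diagonal element normalizes a nonzero vector. -/
theorem exists_normalize {x y s : ℝ} (hxy : 0 < x ^ 2 + y ^ 2) (hs : 0 < s) :
    ∃ u : SL(2, ℝ), u⁻¹ * unip x y * u = unip s 0 ∧
      Joins (proj 1) (proj u) (4 + |Real.log (s ^ 2 / (x ^ 2 + y ^ 2))|) := by
  obtain ⟨θ, hθ, hc, hsn⟩ := exists_polar x (-y)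
  rw [neg_sq] at hc hsn
  have hℓ := Real.sqrt_pos.2 hxy
  have hℓ2 := Real.sq_sqrt hxy.le
  set ℓ := √(x ^ 2 + y ^ 2)
  set t := Real.log (ℓ ^ 2 / s ^ 2) with ht
  have e1 : Real.exp (t / 2) = ℓ / s := by
    have : t / 2 = Real.log (ℓ / s) := by rw [ht, ← div_pow, Real.log_pow]; push_cast; ring
    rw [this, Real.exp_log (by positivity)]
  refine ⟨kSL θ * aExpSL t, ?_, ?_⟩
  · have hcs := Real.sin_sq_add_cos_sq θ
    have h1 := conj_unip (kSL θ * aExpSL t)⁻¹ x y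
    rw [inv_inv] at h1
    rw [h1]
    simp only [inv_val, mul_val, kSL_val, aExpSL_val, Matrix.of_apply, Matrix.cons_val',
      Matrix.cons_val_zero, Matrix.cons_val_one, Matrix.cons_val_fin_one, Real.exp_neg, e1]
    have hy : y = -(ℓ * Real.sin θ) := by linarith
    rw [hc, hy]
    congr 1
    · field_simp
      linear_combination s * hcs
    · field_simp
      ring
  · refine ((joins_kSL θ).mul (joins_aExpSL t)).mono ?_
    have e2 : t = -Real.log (s ^ 2 / (x ^ 2 + y ^ 2)) := by
      rw [ht, hℓ2, ← Real.log_inv, inv_div]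
    rw [e2, abs_neg]
    linarith [Real.pi_le_four]

open MeasureTheory in
/-- Every point of a non-compact quotient sees a unipotent element whose fixed vector is as short as
its distance to the base point permits. -/
theorem exists_short_unip [MeasurableSpace PSL2R] [BorelSpace PSL2R]
    {μ : Measure PSL2R} [μ.IsHaarMeasure] {Γ : Subgroup PSL2R} (hΓ : IsLattice μ Γ)
    (hX : ¬ CompactSpace (X Γ)) (g₀ : SL(2, ℝ)) :
    ∃ C > 0, ∀ g : SL(2, ℝ), ∃ x y : ℝ, 0 < x ^ 2 + y ^ 2 ∧ g * unip x y * g⁻¹ ∈ lift Γ ∧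
      x ^ 2 + y ^ 2 ≤ C * Real.exp (-dX Γ (pt Γ (proj g)) (pt Γ (proj g₀))) := by
  obtain ⟨ε₁, hε₁, hε100, htr⟩ := exists_trace_eq_two hΓ
  set ε := ε₁ / 2 with hεdef
  have hε : 0 < ε := by positivity
  obtain ⟨R, hR0, hR⟩ := exists_bound_of_isThick hΓ hε
  have thin : ∀ g, ¬ IsThick Γ ε g → ∃ x y : ℝ, IsShortest Γ g (unip x y) ∧
      size (unip x y) < ε := by
    intro g hg
    obtain ⟨n, hn⟩ := exists_isShortest hΓ.discrete g
    have hlt : size n < ε := by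
      by_contra hle
      exact hg (hn.isThick (not_lt.1 hle))
    obtain ⟨x, y, h1, h2⟩ := hn.exists_unip (htr g n hn (by linarith))
    exact ⟨x, y, h1, h2.trans_lt hlt⟩
  have pos_of_ne : ∀ x y : ℝ, unip x y ≠ 1 → 0 < x ^ 2 + y ^ 2 := by
    intro x y h
    by_contra hn
    exact h (unip_eq_one_iff.2 ⟨by nlinarith, by nlinarith⟩)
  -- The only use of non-compactness: it provides one unipotent element `n₀` of the lattice.
  have hpar : ∃ g : SL(2, ℝ), ¬ IsThick Γ ε g := by
    by_contra! hall
    exact hX (compactSpace_X fun g => hR g (hall g))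
  obtain ⟨k, hk⟩ := hpar
  obtain ⟨x₀, y₀, hsh₀, -⟩ := thin k hk
  set n₀ := k * unip x₀ y₀ * k⁻¹ with hn₀
  set A := 2 * (R * nsq n₀.1 * R) + 4 with hA
  set D₀ := 4 + R * nsq g₀.1 + (R * nsq g₀.1) ^ 2 with hD₀
  have hA0 : 0 ≤ A := by
    have := nsq_nonneg n₀.1
    positivity
  refine ⟨(A + 1) * Real.exp D₀ + √ε * Real.exp (D₀ + 4), by positivity, fun g => ?_⟩
  by_cases hg : IsThick Γ ε g
  -- At a thick point the distance to the base point is bounded, so a bounded conjugate of `n₀`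
  -- suffices.
  · obtain ⟨c, hc, f, hgf, hf⟩ := hR g hg
    have hconj := conj_unip (f⁻¹ * k) x₀ y₀
    set x := (f⁻¹ * k).1 0 0 * x₀ + (f⁻¹ * k).1 0 1 * y₀
    set y := (f⁻¹ * k).1 1 0 * x₀ + (f⁻¹ * k).1 1 1 * y₀
    have e : unip x y = f⁻¹ * n₀ * f := by rw [← hconj, hn₀]; group
    have hD : dX Γ (pt Γ (proj g)) (pt Γ (proj g₀)) ≤ D₀ := by
      rw [show pt Γ (proj g) = pt Γ (proj f) from pt_eq_iff.2 ⟨c, hc, hgf⟩]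
      exact (dX_le _ _).trans (dG_le (joins_of_nsq_bounds hf))
    refine ⟨x, y, pos_of_ne x y ?_, ?_, ?_⟩
    · intro h1
      rw [e] at h1
      apply hsh₀.ne_one
      have : unip x₀ y₀ = k⁻¹ * (f * (f⁻¹ * n₀ * f) * f⁻¹) * k := by rw [hn₀]; group
      rw [this, h1]; simp
    · have : g * unip x y * g⁻¹ = c * n₀ * c⁻¹ := by rw [e, hgf]; group
      rw [this]
      exact (lift Γ).mul_mem ((lift Γ).mul_mem hc hsh₀.mem) ((lift Γ).inv_mem hc)
    · have h1 := size_unip x y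
      have h2 := size_le_nsq (unip x y)
      have h3 : nsq (unip x y).1 ≤ R * nsq n₀.1 * R := by
        rw [e]
        refine (nsq_mul_val_le _ _).trans (mul_le_mul ?_ hf (nsq_nonneg _) ?_)
        · refine (nsq_mul_val_le _ _).trans ?_
          rw [nsq_inv]
          exact mul_le_mul_of_nonneg_right hf (nsq_nonneg _)
        · exact mul_nonneg hR0 (nsq_nonneg _)
      have h4 : x ^ 2 + y ^ 2 ≤ A + 1 := by nlinarith [sq_nonneg (x ^ 2 + y ^ 2 - 1)]
      have h5 : 1 ≤ Real.exp D₀ * Real.exp (-dX Γ (pt Γ (proj g)) (pt Γ (proj g₀))) := by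
        rw [← Real.exp_add]
        exact Real.one_le_exp (by linarith)
      have h6 : 0 ≤ √ε * Real.exp (D₀ + 4) *
        Real.exp (-dX Γ (pt Γ (proj g)) (pt Γ (proj g₀))) := by positivity
      rw [add_mul, mul_assoc]
      have h7 : (A + 1) * 1 ≤ (A + 1) * (Real.exp D₀ *
          Real.exp (-dX Γ (pt Γ (proj g)) (pt Γ (proj g₀)))) :=
        mul_le_mul_of_nonneg_left h5 (by linarith)
      linarith
  · obtain ⟨x, y, hsh, hlt⟩ := thin g hg
    have hpos := pos_of_ne x y hsh.ne_one
    refine ⟨x, y, hpos, hsh.mem, ?_⟩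
    -- Chosen so that `unip s 0` has size `s⁴ = ε`, the boundary of the thick part.
    set s := √(√ε) with hs
    have hs0 : 0 < s := Real.sqrt_pos.2 (Real.sqrt_pos.2 hε)
    have hs2 : s ^ 2 = √ε := Real.sq_sqrt (Real.sqrt_nonneg _)
    have hs4 : (s ^ 2) ^ 2 = ε := by rw [hs2, Real.sq_sqrt hε.le]
    obtain ⟨u, hu, hj⟩ := exists_normalize hpos hs0
    have hsu : size (u⁻¹ * unip x y * u) = ε := by
      rw [hu, size_unip, ← hs4]; ring
    have hsh' := hsh.conj hΓ.discrete (by linarith) (u := u) (by linarith)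
    obtain ⟨c, hc, f, hgf, hf⟩ := hR _ (hsh'.isThick hsu.ge)
    have hle : x ^ 2 + y ^ 2 ≤ s ^ 2 := by
      rw [size_unip, ← hs4] at hlt
      exact (lt_of_pow_lt_pow_left₀ 2 (by positivity) hlt).le
    have hlog : 0 ≤ Real.log (s ^ 2 / (x ^ 2 + y ^ 2)) :=
      Real.log_nonneg ((one_le_div hpos).2 hle)
    rw [abs_of_nonneg hlog] at hj
    have hD : dX Γ (pt Γ (proj g)) (pt Γ (proj g₀)) ≤
        4 + Real.log (s ^ 2 / (x ^ 2 + y ^ 2)) + D₀ := by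
      have e : g = c * (f * u⁻¹) := by rw [← mul_assoc, ← hgf]; group
      rw [show pt Γ (proj g) = pt Γ (proj (f * u⁻¹)) from pt_eq_iff.2 ⟨c, hc, e⟩]
      refine (dX_le _ _).trans (dG_le (Joins.trans ?_ (joins_of_nsq_bounds hf)))
      have h1 := hj.mul_left (f * u⁻¹)
      have e1 : proj (f * u⁻¹) * proj 1 = proj (f * u⁻¹) := mul_one _
      have e2 : proj (f * u⁻¹) * proj u = proj f := by
        change proj (f * u⁻¹ * u) = _; rw [inv_mul_cancel_right]
      rwa [e1, e2] at h1
    have h5 : x ^ 2 + y ^ 2 ≤ √ε * Real.exp (D₀ + 4) *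
        Real.exp (-dX Γ (pt Γ (proj g)) (pt Γ (proj g₀))) := by
      rw [mul_assoc, ← Real.exp_add, ← hs2]
      have h6 : Real.exp (-Real.log (s ^ 2 / (x ^ 2 + y ^ 2))) ≤
          Real.exp (D₀ + 4 + -dX Γ (pt Γ (proj g)) (pt Γ (proj g₀))) :=
        Real.exp_le_exp.2 (by linarith)
      rw [← Real.log_inv, Real.exp_log (by positivity), inv_div] at h6
      calc x ^ 2 + y ^ 2 = s ^ 2 * ((x ^ 2 + y ^ 2) / s ^ 2) := by field_simp
        _ ≤ _ := mul_le_mul_of_nonneg_left h6 (by positivity)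
    have h6 : 0 ≤ (A + 1) * Real.exp D₀ *
        Real.exp (-dX Γ (pt Γ (proj g)) (pt Γ (proj g₀))) := by positivity
    rw [add_mul]
    linarith

/-- Fixed vectors of unipotent elements are not shorter than the distance to the base point
permits. -/
theorem exists_unip_lower_bound {Γ : Subgroup PSL2R} (hΓ : DiscreteTopology Γ) (g₀ : SL(2, ℝ)) :
    ∃ c > 0, ∀ (g : SL(2, ℝ)) (x y : ℝ), 0 < x ^ 2 + y ^ 2 → g * unip x y * g⁻¹ ∈ lift Γ →
      c * Real.exp (-dX Γ (pt Γ (proj g)) (pt Γ (proj g₀))) ≤ x ^ 2 + y ^ 2 := by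
  obtain ⟨n, hn⟩ := exists_isShortest hΓ g₀
  have hpos : 0 < size n :=
    lt_of_le_of_ne (size_nonneg n) fun h => hn.ne_one (size_eq_zero_iff.1 h.symm)
  refine ⟨√(size n) * Real.exp (-1), by positivity, fun g x y hxy hmem => ?_⟩
  obtain ⟨k₁, k₂, h1, h2, hj⟩ := exists_joins_of_dX_lt
    (lt_add_one (dX Γ (pt Γ (proj g)) (pt Γ (proj g₀))))
  set D := dX Γ (pt Γ (proj g)) (pt Γ (proj g₀))
  obtain ⟨m₁, m₂, rfl, rfl, hgrow⟩ := hj.norm_growth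
  obtain ⟨c₁, hc₁, e₁⟩ := pt_eq_iff.1 h1
  obtain ⟨c₂, hc₂, e₂⟩ := pt_eq_iff.1 h2
  have hg := hgrow x y
  have hconj := conj_unip (m₂⁻¹ * m₁) x y
  set x' := (m₂⁻¹ * m₁).1 0 0 * x + (m₂⁻¹ * m₁).1 0 1 * y
  set y' := (m₂⁻¹ * m₁).1 1 0 * x + (m₂⁻¹ * m₁).1 1 1 * y
  have hne : unip x' y' ≠ 1 := by
    rw [← hconj]
    intro h
    rw [conj_eq_one_iff, unip_eq_one_iff] at h
    rw [h.1, h.2] at hxy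
    norm_num at hxy
  -- The vector transported to the base point still belongs to a nontrivial element of `g₀⁻¹ Γ g₀`.
  have hsz : size n ≤ size (unip x' y') := by
    refine hn.le _ hne ?_
    have e : g₀ * unip x' y' * g₀⁻¹ = c₂⁻¹ * (c₁ * (g * unip x y * g⁻¹) * c₁⁻¹) * c₂ := by
      rw [← hconj, e₁, e₂]; group
    rw [e]
    exact (lift Γ).mul_mem ((lift Γ).mul_mem ((lift Γ).inv_mem hc₂)
      ((lift Γ).mul_mem ((lift Γ).mul_mem hc₁ hmem) ((lift Γ).inv_mem hc₁))) hc₂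
  rw [size_unip] at hsz
  have h3 : √(size n) ≤ x' ^ 2 + y' ^ 2 := Real.sqrt_le_iff.2 ⟨by positivity, hsz⟩
  have h4 := h3.trans hg
  calc √(size n) * Real.exp (-1) * Real.exp (-D)
      ≤ Real.exp (D + 1) * (x ^ 2 + y ^ 2) * Real.exp (-1) * Real.exp (-D) := by gcongr
    _ = (x ^ 2 + y ^ 2) * Real.exp (D + 1 + -1 + -D) := by
        rw [Real.exp_add (D + 1 + -1), Real.exp_add (D + 1)]; ring
    _ = x ^ 2 + y ^ 2 := by
        rw [show D + 1 + -1 + -D = 0 by ring, Real.exp_zero, mul_one]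

/-! ### Closed horocycles near a given orbit -/

theorem size_hSL (t : ℝ) : size (hSL t) = t ^ 2 := by
  rw [size_eq]; simp [hSL_val]

theorem hSL_mul (s t : ℝ) : hSL s * hSL t = hSL (s + t) := by
  apply sl_ext <;> simp [hSL_val]; ring

theorem hflow_pt (Γ : Subgroup PSL2R) (t : ℝ) (g : SL(2, ℝ)) :
    hflow Γ t (pt Γ (proj g)) = pt Γ (proj (g * hSL t)) := rfl

theorem hflow_eq_self_iff {Γ : Subgroup PSL2R} {t : ℝ} {g : SL(2, ℝ)} :
    hflow Γ t (pt Γ (proj g)) = pt Γ (proj g) ↔ g * hSL t * g⁻¹ ∈ lift Γ := by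
  rw [hflow_pt, pt_eq_iff]
  constructor
  · rintro ⟨c, hc, e⟩
    rw [e, mul_inv_cancel_right]; exact hc
  · intro h
    exact ⟨_, h, by group⟩

/-- Discreteness leaves finitely many periods up to `z²`. Since `z²` need not be the least one, the
unipotent element of the exact period is returned too, for the lower bound on `P`. -/
theorem exists_isClosedHorocycle {Γ : Subgroup PSL2R} (hΓ : DiscreteTopology Γ) {g : SL(2, ℝ)}
    {z : ℝ} (hz : z ≠ 0) (h : g * unip z 0 * g⁻¹ ∈ lift Γ) :
    ∃ P, 0 < P ∧ P ≤ z ^ 2 ∧ IsClosedHorocycle Γ (pt Γ (proj g)) P ∧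
      g * unip (√P) 0 * g⁻¹ ∈ lift Γ := by
  have hfin : {t : ℝ | (0 < t ∧ t ≤ z ^ 2) ∧ g * hSL t * g⁻¹ ∈ lift Γ}.Finite := by
    refine Set.Finite.of_finite_image (f := hSL)
      ((finite_conj_size_le hΓ g ((z ^ 2) ^ 2)).subset ?_) ?_
    · rintro _ ⟨t, ⟨⟨h1, h2⟩, h3⟩, rfl⟩
      exact ⟨h3, by rw [size_hSL]; exact pow_le_pow_left₀ h1.le h2 2⟩
    · intro a _ b _ hab
      have := congrArg (fun m : SL(2, ℝ) => m.1 0 1) hab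
      simpa [hSL_val] using this
  have hz2 : 0 < z ^ 2 := by positivity
  rw [unip_zero_right] at h
  obtain ⟨P, hP, hmin⟩ := hfin.exists_minimalFor id _ ⟨z ^ 2, ⟨hz2, le_rfl⟩, h⟩
  refine ⟨P, hP.1.1, hP.1.2, ⟨⟨hP.1.1, hflow_eq_self_iff.2 hP.2⟩, ?_⟩, ?_⟩
  · rintro t ⟨ht, hfix⟩
    rw [hflow_eq_self_iff] at hfix
    rcases le_total t (z ^ 2) with h1 | h1
    · by_contra hlt
      exact hlt (hmin ⟨⟨ht, h1⟩, hfix⟩ (not_le.1 hlt).le)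
    · exact hP.1.2.trans h1
  · rw [unip_zero_right, Real.sq_sqrt hP.1.1.le]; exact hP.2

/-- The matrix `(1 0; c 1)` in `SL₂(ℝ)`. -/
def lowSL (c : ℝ) : SL(2, ℝ) := ⟨!![1, 0; c, 1], by simp [Matrix.det_fin_two_of]⟩

theorem lowSL_val (c : ℝ) : (lowSL c).1 = !![1, 0; c, 1] := rfl

/-- Quadratic divergence of nearby horocycles, the origin of `K²` in the theorem. -/
theorem joins_conj_lowSL (c τ : ℝ) :
    Joins (proj 1) (proj (hSL (-τ) * lowSL c * hSL τ)) (|c| * (2 + τ ^ 2)) := by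
  refine (joins_nilpotent (-(τ * c)) (-(τ ^ 2 * c)) c (by ring) _ ?_).mono ?_
  · ext i j
    fin_cases i <;> fin_cases j <;> simp [hSL_val, lowSL_val] <;> ring
  · refine Real.sqrt_le_iff.2 ⟨by positivity, ?_⟩
    rw [mul_pow |c|, sq_abs]
    nlinarith [mul_nonneg (sq_nonneg c) (sq_nonneg τ), sq_nonneg c]

/-- A unipotent element of `g⁻¹ Γ g` whose fixed vector becomes sufficiently close to horizontal
at the middle of a piece of the horocycle orbit of `Γ g` yields a closed horocycle following this
piece. -/
theorem exists_approximates {Γ : Subgroup PSL2R} (hΓ : DiscreteTopology Γ) {g : SL(2, ℝ)}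
    {x y δ K κ t₀ : ℝ} (hmem : g * unip x y * g⁻¹ ∈ lift Γ) (hκ : K ≤ 2 * κ)
    (hz : (2 + κ ^ 2) * |y| < δ * |x - (t₀ + κ) * y|) :
    ∃ (ξ : X Γ) (P : ℝ), 0 < P ∧ P ≤ (x - (t₀ + κ) * y) ^ 2 ∧ IsClosedHorocycle Γ ξ P ∧
      Approximates Γ δ K (pt Γ (proj g)) t₀ ξ ∧
      g * unip (√P / (x - (t₀ + κ) * y) * x) (√P / (x - (t₀ + κ) * y) * y) * g⁻¹ ∈ lift Γ := by
  set z := x - (t₀ + κ) * y with hzdef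
  have hz0 : z ≠ 0 := by
    intro h
    rw [h, abs_zero, mul_zero] at hz
    have : 0 ≤ (2 + κ ^ 2) * |y| := by positivity
    linarith
  -- Go to the midpoint of the piece, shear the vector to the horizontal, and go back by `κ`: `u`
  -- sends `(z, 0)` to `(x, y)`, and times differ from the midpoint by at most `κ`.
  set u := hSL (t₀ + κ) * lowSL (y / z) * hSL (-κ) with hu
  have hconj : ∀ q : ℝ, u * unip q 0 * u⁻¹ = unip (q / z * x) (q / z * y) := by
    intro q
    rw [conj_unip]
    have hx : x = z + (t₀ + κ) * y := by rw [hzdef]; ring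
    congr 1
    · simp only [hu, mul_val, hSL_val, lowSL_val, Matrix.of_apply, Matrix.cons_val',
        Matrix.cons_val_zero, Matrix.cons_val_one, Matrix.cons_val_fin_one]
      rw [hx]
      field_simp
      ring
    · simp only [hu, mul_val, hSL_val, lowSL_val, Matrix.of_apply, Matrix.cons_val',
        Matrix.cons_val_zero, Matrix.cons_val_one, Matrix.cons_val_fin_one]
      field_simp
      ring
  have hmem' : g * u * unip z 0 * (g * u)⁻¹ ∈ lift Γ := by
    have e : g * u * unip z 0 * (g * u)⁻¹ = g * (u * unip z 0 * u⁻¹) * g⁻¹ := by group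
    rw [e, hconj, div_self hz0, one_mul, one_mul]; exact hmem
  obtain ⟨P, hP0, hPz, hcl, hPm⟩ := exists_isClosedHorocycle hΓ hz0 hmem'
  refine ⟨_, P, hP0, hPz, hcl, ?_, ?_⟩
  · intro t ht0 htK
    rw [hflow_pt, hflow_pt]
    have e : proj (g * u * hSL t) = proj (g * hSL (t₀ + t)) *
        proj (hSL (-(t - κ)) * lowSL (y / z) * hSL (t - κ)) := by
      change _ = proj (g * hSL (t₀ + t) * (hSL (-(t - κ)) * lowSL (y / z) * hSL (t - κ)))
      congr 1
      rw [hu, show t₀ + κ = t₀ + t + -(t - κ) by ring, ← hSL_mul, sub_eq_add_neg t κ, add_comm t,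
        ← hSL_mul (-κ) t]
      group
    rw [e]
    refine (dX_le _ _).trans ((dG_mul_le (joins_conj_lowSL _ _)).trans ?_)
    have hτ : (t - κ) ^ 2 ≤ κ ^ 2 := by nlinarith
    rw [abs_div, div_mul_eq_mul_div, div_le_iff₀ (abs_pos.2 hz0)]
    have : |y| * (2 + (t - κ) ^ 2) ≤ |y| * (2 + κ ^ 2) :=
      mul_le_mul_of_nonneg_left (by linarith) (abs_nonneg y)
    linarith
  · have e : g * u * unip (√P) 0 * (g * u)⁻¹ = g * (u * unip (√P) 0 * u⁻¹) * g⁻¹ := by group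
    rw [e, hconj] at hPm
    exact hPm

/-- For `y ≠ 0` the inequality can fail only within `ρ` of the zero `t = x / y - κ`; this interval
is clamped to `[0, T]`. -/
theorem exists_bad_interval {x y : ℝ} (hxy : x ≠ 0 ∨ y ≠ 0) {ρ T : ℝ} (κ : ℝ) (hρ : 0 ≤ ρ)
    (hT : 0 ≤ T) : ∃ a b : ℝ, 0 ≤ a ∧ a ≤ b ∧ b ≤ T ∧ b - a ≤ 2 * ρ ∧
      ∀ t ∈ Set.Icc 0 T \ Set.Icc a b, ρ * |y| < |x - (t + κ) * y| := by
  by_cases hy : y = 0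
  · refine ⟨0, 0, le_rfl, le_rfl, hT, by simpa using hρ, fun t _ => ?_⟩
    have hx : x ≠ 0 := hxy.resolve_right (not_not.2 hy)
    simpa [hy] using hx
  · set q := x / y - κ with hq
    refine ⟨max 0 (min T (q - ρ)), max 0 (min T (q + ρ)), le_max_left _ _,
      max_le_max le_rfl (min_le_min le_rfl (by linarith)), max_le hT (min_le_left _ _), ?_, ?_⟩
    · rcases le_total T (q - ρ) with h1 | h1 <;> rcases le_total T (q + ρ) with h2 | h2 <;>
        simp only [min_eq_left, min_eq_right, h1, h2] <;>
        rcases le_total 0 (q - ρ) with h3 | h3 <;> rcases le_total 0 (q + ρ) with h4 | h4 <;>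
        simp only [max_eq_left, max_eq_right, h3, h4, hT] <;> linarith
    · rintro t ⟨⟨ht0, htT⟩, hab⟩
      have e : x - (t + κ) * y = (q - t) * y := by rw [hq]; field_simp; ring
      rw [e, abs_mul]
      refine mul_lt_mul_of_pos_right ?_ (abs_pos.2 hy)
      rw [Set.mem_Icc, not_and_or, not_le, not_le] at hab
      rcases hab with h | h
      · have h1 := ((lt_max_iff.1 h).resolve_left (not_lt.2 ht0)).trans_le (min_le_right _ _)
        exact lt_abs.2 (Or.inl (by linarith))
      · have h1 := ((max_lt_iff.1 h).2)
        have h2 := (min_lt_iff.1 h1).resolve_left (not_lt.2 htT)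
        exact lt_abs.2 (Or.inr (by linarith))

theorem sq_sub_mul_le {x y σ : ℝ} (h0 : 0 ≤ σ) (h1 : σ ≤ 3 / 2) :
    (x - σ * y) ^ 2 ≤ 4 * (x ^ 2 + y ^ 2) := by
  have h7 : (x - σ * y) ^ 2 ≤ (1 + σ ^ 2) * (x ^ 2 + y ^ 2) := by
    nlinarith [sq_nonneg (y + σ * x)]
  have h8 : σ ^ 2 ≤ 3 := by nlinarith
  exact h7.trans (mul_le_mul_of_nonneg_right (by linarith) (by positivity))

/-- Writing `x = (x - σ y) + σ y` bounds `η |x|` by `4 |x - σ y|`, and `20 = 4² + 2²`. So away from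
the bad time the horizontal component controls the whole vector. -/
theorem mul_sq_add_sq_le {x y σ η : ℝ} (h0 : 0 ≤ σ) (h1 : σ ≤ 3 / 2) (hη0 : 0 ≤ η) (hη1 : η ≤ 1)
    (h : η * |y| ≤ 2 * |x - σ * y|) : η ^ 2 * (x ^ 2 + y ^ 2) ≤ 20 * (x - σ * y) ^ 2 := by
  rw [← sq_abs (x - σ * y)]
  set Y := |x - σ * y| with hY
  have hY0 : 0 ≤ Y := abs_nonneg _
  have hxY : |x| ≤ Y + 3 / 2 * |y| := by
    calc |x| = |(x - σ * y) + σ * y| := by congr 1; ring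
      _ ≤ Y + |σ * y| := abs_add_le _ _
      _ ≤ Y + 3 / 2 * |y| := by
        rw [abs_mul, abs_of_nonneg h0]
        have := mul_le_mul_of_nonneg_right h1 (abs_nonneg y)
        linarith
  have hxη : η * |x| ≤ 4 * Y := by
    have h2 := mul_le_mul_of_nonneg_left hxY hη0
    have h3 := mul_le_mul_of_nonneg_right hη1 hY0
    linarith
  have h8 : (η * |x|) ^ 2 ≤ (4 * Y) ^ 2 := pow_le_pow_left₀ (by positivity) hxη 2
  have h9 : (η * |y|) ^ 2 ≤ (2 * Y) ^ 2 := pow_le_pow_left₀ (by positivity) h 2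
  rw [mul_pow, sq_abs] at h8 h9
  linarith

theorem conj_aExpSL_log {T : ℝ} (hT : 0 < T) (g : SL(2, ℝ)) (v w : ℝ) :
    g * aExpSL (Real.log T) * unip v w * (g * aExpSL (Real.log T))⁻¹ =
      g * unip (√T * v) (w / √T) * g⁻¹ := by
  have e1 : Real.exp (Real.log T / 2) = √T := by rw [Real.exp_half, Real.exp_log hT]
  have e : g * aExpSL (Real.log T) * unip v w * (g * aExpSL (Real.log T))⁻¹ =
      g * (aExpSL (Real.log T) * unip v w * (aExpSL (Real.log T))⁻¹) * g⁻¹ := by group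
  rw [e, conj_unip]
  congr 3 <;>
  · simp only [aExpSL_val, Matrix.of_apply, Matrix.cons_val', Matrix.cons_val_zero,
      Matrix.cons_val_one, Matrix.cons_val_fin_one, Real.exp_neg, e1]
    ring

/-- The closed horocycle following a piece of the orbit of `Γ g`, with its period estimated in terms
of a fixed vector at the renormalized point `Γ g a(T)`. -/
theorem exists_approximates_renormalized {Γ : Subgroup PSL2R} (hΓ : DiscreteTopology Γ)
    {g : SL(2, ℝ)} {x y T δ K κ t₀ ρ : ℝ} (hT : 0 < T) (hxy : 0 < x ^ 2 + y ^ 2)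
    (hmem : g * aExpSL (Real.log T) * unip x y * (g * aExpSL (Real.log T))⁻¹ ∈ lift Γ)
    (hKκ : K ≤ 2 * κ) (hκ0 : 0 ≤ κ) (hκT : κ ≤ T / 2) (ht0 : 0 ≤ t₀) (htT : t₀ ≤ T) (hδ : 0 < δ)
    (hρ : δ⁻¹ * (2 + κ ^ 2) ≤ ρ) (hlt : ρ * |y / √T| < |√T * x - (t₀ + κ) * (y / √T)|) :
    ∃ (ξ : X Γ) (P : ℝ), IsClosedHorocycle Γ ξ P ∧ Approximates Γ δ K (pt Γ (proj g)) t₀ ξ ∧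
      P ≤ 4 * T * (x ^ 2 + y ^ 2) ∧
      ∀ c η : ℝ, (∀ v w : ℝ, 0 < v ^ 2 + w ^ 2 →
        g * aExpSL (Real.log T) * unip v w * (g * aExpSL (Real.log T))⁻¹ ∈ lift Γ →
        c ≤ v ^ 2 + w ^ 2) → 0 < η → η < 1 → η * T / 2 ≤ ρ → c * T * η ^ 2 ≤ 20 * P := by
  simp only [conj_aExpSL_log hT] at hmem ⊢
  have hS := Real.sqrt_pos.2 hT
  have hS2 := Real.sq_sqrt hT.le
  set S := √T
  have hρ0 : 0 ≤ ρ := le_trans (by positivity) hρ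
  have hlt' : (2 + κ ^ 2) * |y / S| < δ * |S * x - (t₀ + κ) * (y / S)| := by
    have : δ⁻¹ * (2 + κ ^ 2) * |y / S| < |S * x - (t₀ + κ) * (y / S)| :=
      (mul_le_mul_of_nonneg_right hρ (abs_nonneg _)).trans_lt hlt
    calc (2 + κ ^ 2) * |y / S| = δ * (δ⁻¹ * (2 + κ ^ 2) * |y / S|) := by field_simp
      _ < _ := mul_lt_mul_of_pos_left this hδ
  obtain ⟨ξ, P, hP0, hPz, hcl, happ, hPm⟩ := exists_approximates hΓ hmem hKκ hlt'
  set σ := (t₀ + κ) / T with hσ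
  have hσ0 : 0 ≤ σ := by positivity
  have hσ1 : σ ≤ 3 / 2 := by rw [hσ, div_le_iff₀ hT]; linarith
  have hz : S * x - (t₀ + κ) * (y / S) = S * (x - σ * y) := by
    rw [hσ, ← hS2]; field_simp
  rw [hz] at hPz hPm hlt
  refine ⟨ξ, P, hcl, happ, ?_, fun c η hc hη0 hη1 hηρ => ?_⟩
  · rw [mul_pow, hS2] at hPz
    have := mul_le_mul_of_nonneg_left (sq_sub_mul_le (x := x) (y := y) hσ0 hσ1) hT.le
    linarith
  · have hYy : η * |y| ≤ 2 * |x - σ * y| := by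
      have h6 : η * T / 2 * |y / S| < |S * (x - σ * y)| :=
        (mul_le_mul_of_nonneg_right hηρ (abs_nonneg _)).trans_lt hlt
      rw [abs_div, abs_mul, abs_of_pos hS, ← hS2] at h6
      have h7 : η * S ^ 2 / 2 * (|y| / S) = S * (η * |y| / 2) := by field_simp
      rw [h7] at h6
      have := lt_of_mul_lt_mul_left h6 hS.le
      linarith
    have hd0 : x - σ * y ≠ 0 := by
      intro h
      rw [h, mul_zero, abs_zero] at hlt
      exact absurd hlt (not_lt.2 (mul_nonneg hρ0 (abs_nonneg _)))
    have hd : 0 < (x - σ * y) ^ 2 := by positivity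
    have hsum := mul_sq_add_sq_le hσ0 hσ1 hη0.le hη1.le hYy
    have hl2 : (√P / (S * (x - σ * y))) ^ 2 = P / (T * (x - σ * y) ^ 2) := by
      rw [div_pow, Real.sq_sqrt hP0.le, mul_pow, hS2]
    set l := √P / (S * (x - σ * y))
    set Q := (x - σ * y) ^ 2
    have e : (l * x) ^ 2 + (l * y) ^ 2 = P * (x ^ 2 + y ^ 2) / (T * Q) := by
      rw [mul_pow, mul_pow, hl2]; ring
    -- The lower bound is applied to the multiple of the vector that belongs to `P` itself, since
    -- `P` may be much smaller than `z²`.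
    have hl := hc (l * x) (l * y) (by rw [e]; positivity) (by
      rw [show S * (l * x) = l * (S * x) by ring, show l * y / S = l * (y / S) by ring]
      exact hPm)
    rw [e, le_div_iff₀ (by positivity)] at hl
    have h11 : Q * (c * T * η ^ 2) ≤ Q * (20 * P) := by
      calc Q * (c * T * η ^ 2) = η ^ 2 * (c * (T * Q)) := by ring
        _ ≤ η ^ 2 * (P * (x ^ 2 + y ^ 2)) := mul_le_mul_of_nonneg_left hl (by positivity)
        _ = P * (η ^ 2 * (x ^ 2 + y ^ 2)) := by ring
        _ ≤ P * (20 * Q) := mul_le_mul_of_nonneg_left hsum hP0.le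
        _ = Q * (20 * P) := by ring
    exact le_of_mul_le_mul_left h11 hd

end Horocycle

end

/-! ### The theorem: choice of constants and of the exceptional interval. -/

open Horocycle in
theorem lemma1p3
    [MeasurableSpace Horocycle.PSL2R] [BorelSpace Horocycle.PSL2R]
    (μ : MeasureTheory.Measure Horocycle.PSL2R) [μ.IsHaarMeasure]
    (Γ : Subgroup Horocycle.PSL2R) (hΓ : Horocycle.IsLattice μ Γ)
    (hX : ¬ CompactSpace (Horocycle.X Γ)) (p₀ : Horocycle.X Γ) :
    ∃ C : ℝ, 1 ≤ C ∧ ∀ (p : Horocycle.X Γ) (T δ K : ℝ), 0 ≤ T → 0 < δ → K ≤ T →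
      (∃ a b : ℝ, 0 ≤ a ∧ a ≤ b ∧ b ≤ T ∧ b - a ≤ δ⁻¹ * (max K C) ^ 2 ∧
        ∀ t₀ ∈ Set.Icc 0 T \ Set.Icc a b, ∃ (ξ : Horocycle.X Γ) (P : ℝ),
          Horocycle.IsClosedHorocycle Γ ξ P ∧
          Horocycle.Approximates Γ δ K p t₀ ξ ∧
          P ≤ C * Horocycle.r Γ p₀ T p) ∧
      (∀ η : ℝ, 0 < η →
        ∃ a b : ℝ, 0 ≤ a ∧ a ≤ b ∧ b ≤ T ∧ b - a ≤ max (δ⁻¹ * (max K C) ^ 2) (η * T) ∧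
        ∀ t₀ ∈ Set.Icc 0 T \ Set.Icc a b, ∃ (ξ : Horocycle.X Γ) (P : ℝ),
          Horocycle.IsClosedHorocycle Γ ξ P ∧
          Horocycle.Approximates Γ δ K p t₀ ξ ∧
          P ≤ C * Horocycle.r Γ p₀ T p ∧
          C⁻¹ * η ^ 2 * Horocycle.r Γ p₀ T p ≤ P) := by
  obtain ⟨q₀, rfl⟩ := Quotient.exists_rep p₀
  obtain ⟨g₀, rfl⟩ := QuotientGroup.mk_surjective q₀
  obtain ⟨C₀, hC₀, hshort⟩ := exists_short_unip hΓ hX g₀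
  obtain ⟨c₀, hc₀, hlow⟩ := exists_unip_lower_bound hΓ.discrete g₀
  -- `4 * C₀` and `20 / c₀` serve the two bounds for the period; 3 ensures `4 + max(K,0)²/2 ≤
  -- max(K,C)²`, needed for the length of the interval.
  set C := max 3 (max (4 * C₀) (20 / c₀)) with hC
  have hC3 : 3 ≤ C := le_max_left _ _
  have hCC₀ : 4 * C₀ ≤ C := (le_max_left _ _).trans (le_max_right _ _)
  have hCc₀ : C⁻¹ ≤ c₀ / 20 := by
    rw [← inv_div]
    exact inv_anti₀ (by positivity) ((le_max_right _ _).trans (le_max_right _ _))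
  refine ⟨C, by linarith, fun p T δ K hT hδ hKT => ?_⟩
  rcases hT.eq_or_lt with rfl | hT0
  · refine ⟨⟨0, 0, le_rfl, le_rfl, le_rfl, by simp only [sub_zero]; positivity, ?_⟩,
      fun η hη => ⟨0, 0, le_rfl, le_rfl, le_rfl, by simp, ?_⟩⟩ <;>
    · rintro t ⟨h1, h2⟩
      exact absurd h1 h2
  obtain ⟨q, rfl⟩ := Quotient.exists_rep p
  obtain ⟨g, rfl⟩ := QuotientGroup.mk_surjective q
  set a := aExpSL (Real.log T)
  obtain ⟨x, y, hxy, hmem, hup⟩ := hshort (g * a)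
  have hlow' := hlow (g * a)
  set E := Real.exp (-dX Γ (pt Γ (proj (g * a))) (pt Γ (proj g₀)))
  have hE0 : 0 < E := Real.exp_pos _
  have hS := Real.sqrt_pos.2 hT0
  -- Half the length of the piece; `K` may be negative.
  set κ := max K 0 / 2 with hκ
  have hκ0 : 0 ≤ κ := by positivity
  have hκT : κ ≤ T / 2 := by
    have : max K 0 ≤ T := max_le hKT hT
    linarith
  have hKκ : K ≤ 2 * κ := by linarith [le_max_left K 0]
  set M := δ⁻¹ * (2 + κ ^ 2) with hM
  have hM2 : 2 * M ≤ δ⁻¹ * max K C ^ 2 := by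
    have h1 : max K 0 ≤ max K C := max_le_max le_rfl (by linarith)
    have h2 : C ≤ max K C := le_max_right _ _
    have h3 : 2 * (2 + κ ^ 2) ≤ max K C ^ 2 := by nlinarith [le_max_right K 0]
    calc 2 * M = δ⁻¹ * (2 * (2 + κ ^ 2)) := by rw [hM]; ring
      _ ≤ _ := mul_le_mul_of_nonneg_left h3 (by positivity)
  have hne : √T * x ≠ 0 ∨ y / √T ≠ 0 := by
    by_contra! h
    have hx : x = 0 := (mul_eq_zero.1 h.1).resolve_left hS.ne'
    have hy : y = 0 := (div_eq_zero_iff.1 h.2).resolve_right hS.ne'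
    rw [hx, hy] at hxy
    norm_num at hxy
  have hM0 : 0 ≤ M := by positivity
  -- Both parts follow from this, with radius `M` for the first and `max M (η T / 2)` for the
  -- second.
  have main : ∀ ρ, M ≤ ρ → ∃ a b : ℝ, 0 ≤ a ∧ a ≤ b ∧ b ≤ T ∧ b - a ≤ 2 * ρ ∧
      ∀ t₀ ∈ Set.Icc 0 T \ Set.Icc a b, ∃ (ξ : X Γ) (P : ℝ), IsClosedHorocycle Γ ξ P ∧
        Approximates Γ δ K (pt Γ (proj g)) t₀ ξ ∧ P ≤ C * (T * E) ∧
        ∀ η, 0 < η → η < 1 → η * T / 2 ≤ ρ → C⁻¹ * η ^ 2 * (T * E) ≤ P := by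
    intro ρ hρ
    obtain ⟨b₁, b₂, h1, h2, h3, h4, h5⟩ := exists_bad_interval hne κ (hM0.trans hρ) hT
    refine ⟨b₁, b₂, h1, h2, h3, h4, fun t₀ ht₀ => ?_⟩
    obtain ⟨ξ, P, hcl, happ, hPu, hPl⟩ := exists_approximates_renormalized hΓ.discrete hT0 hxy hmem
      hKκ hκ0 hκT ht₀.1.1 ht₀.1.2 hδ hρ (h5 t₀ ht₀)
    refine ⟨ξ, P, hcl, happ, ?_, fun η hη0 hη1 hηρ => ?_⟩
    · calc P ≤ 4 * T * (x ^ 2 + y ^ 2) := hPu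
        _ ≤ 4 * T * (C₀ * E) := mul_le_mul_of_nonneg_left hup (by positivity)
        _ = 4 * C₀ * (T * E) := by ring
        _ ≤ C * (T * E) := mul_le_mul_of_nonneg_right hCC₀ (by positivity)
    · have h10 := hPl (c₀ * E) η hlow' hη0 hη1 hηρ
      calc C⁻¹ * η ^ 2 * (T * E) = C⁻¹ * (η ^ 2 * (T * E)) := by ring
        _ ≤ c₀ / 20 * (η ^ 2 * (T * E)) := mul_le_mul_of_nonneg_right hCc₀ (by positivity)
        _ ≤ P := by linarith
  refine ⟨?_, fun η hη => ?_⟩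
  · obtain ⟨b₁, b₂, h1, h2, h3, h4, h5⟩ := main M le_rfl
    refine ⟨b₁, b₂, h1, h2, h3, h4.trans hM2, fun t₀ ht₀ => ?_⟩
    obtain ⟨ξ, P, k1, k2, k3, -⟩ := h5 t₀ ht₀
    exact ⟨ξ, P, k1, k2, k3⟩
  -- For `η ≥ 1` all of `[0, T]` may be discarded.
  · rcases le_or_gt 1 η with hη1 | hη1
    · refine ⟨0, T, le_rfl, hT, le_rfl, le_max_of_le_right (by nlinarith), ?_⟩
      rintro t ⟨h1, h2⟩
      exact absurd h1 h2
    · obtain ⟨b₁, b₂, h1, h2, h3, h4, h5⟩ := main (max M (η * T / 2)) (le_max_left _ _)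
      refine ⟨b₁, b₂, h1, h2, h3, h4.trans ?_, fun t₀ ht₀ => ?_⟩
      · rw [mul_max_of_nonneg _ _ zero_le_two]
        exact max_le_max hM2 (by linarith)
      · obtain ⟨ξ, P, k1, k2, k3, k4⟩ := h5 t₀ ht₀
        exact ⟨ξ, P, k1, k2, k3, k4 η hη hη1 (le_max_right _ _)⟩
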